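/- Let $L$ be the first-order language with identity over the natural numbers having an $n$-ary function symbol for every definition of an $n$-ary primitive recursive function from $0$, successor and projections by composition and primitive recursion. The numeral $0^{(n)}$ is $n$ successor symbols applied to $0$. Fix a usual Hilbert calculus for first-order logic with identity and a standard Gödel numbering of formulas and proofs. Let $S$ be a set of $L$-formulas (the non-logical axioms) whose set of Gödel numbers is primitive recursive, such that $S$ proves the ordinary defining equations of all the function symbols and $\forall x\,(x+1\neq 0)$. A $\Sigma^0_1$ sentence is one of the form $\exists x\,A(x)$, and a $\Pi^0_2$ sentence one of the form $\forall x\exists y\,A(x,y)$, with $A$ quantifier-free and having no other variables. $S$ is *1-consistent* if there is no $\Sigma^0_1$ sentence $\exists x A(x)$ such that $S$ proves $\exists xA(x)$ and all of $\neg A(0^{(n)})$, $n\in\mathbb N$; it is *$\Sigma^0_1$-correct* if every $\Sigma^0_1$ sentence provable in $S$ is true in $\mathbb N$. $S$ is *2-consistent* if there is no quantifier-free $A(x,y)$ such that $S$ proves $\exists x\forall y A(x,y)$ and all of $\neg\forall yA(0^{(n)},y)$; it is *$\omega$-consistent* if there is no formula $A(x)$ with no free variable other than $x$ such that $S$ proves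 $\neg\forall xA(x)$ and all of $A(0^{(n)})$. Then: 1. $S$ is 1-consistent if and only if it is $\Sigma^0_1$-correct. 2. The predicate $P(p)$: "$p$ is the Gödel number of a proof in $S$ of some $\Pi^0_2$ sentence", and the relation $Q(p,q)$: "$p$ is the Gödel number of a proof in $S$ of some $\Pi^0_2$ sentence $\forall x\exists yA(x,y)$, and $q$ is the Gödel number of a proof in $S$ of $A(0^{(p)},0^{(n)})$ for some $n$", are primitive recursive; that is, there are function symbols $f$, $g$ of $L$ such that in $\mathbb N$, for all $p,q$, $f(p)=1\iff P(p)$ and $g(p,q)=1\iff Q(p,q)$. 3. Let $f,g$ be any function symbols with these two properties, and let $(***)$ be the $\Pi^0_2$ sentence $\forall x\exists y\,\bigl(f(x)=1\to g(x,y)=1\bigr)$, saying that for every $x$ there is a $y$ such that if $x$ proves a $\Pi^0_2$ sentence $\forall x\exists yA(x,y)$, then $y$ proves an instance $A(0^{(x)},0^{(n)})$. Then: (a) if $S$ is 1-consistent, $(***)$ is true and is not provable in $S$; (b) if $S$ is inconsistent, $(***)$ is true; (c) if $S$ is 1-consistent or inconsistent, then for every $m$ the numerical instance $\exists y\,\bigl(f(0^{(m)})=1\to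 g(0^{(m)},y)=1\bigr)$ is provable in $S$; (d) if $S$ is 2-consistent, $(***)$ is neither provable nor refutable in $S$, hence undecidable in $S$; (e) in particular, if $S$ is $\omega$-consistent, $(***)$ is undecidable in $S$. -/

import Mathlib

namespace PRArith

/-! ## Syntax: arithmetic with a symbol for every primitive recursive function -/

/-- Function symbols of arity `n`: one for every definition of an `n`-ary primitive recursive
function from zero, successor and projections by composition and primitive recursion. -/
inductive PRSym : ℕ → Type
  | zero : PRSym 0
  | succ : PRSym 1
  | proj {n : ℕ} (i : Fin n) : PRSym n
  | comp {m n : ℕ} (f : PRSym n) (g : Fin n → PRSym m) : PRSym m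
  | prec {n : ℕ} (f : PRSym n) (g : PRSym (n + 2)) : PRSym (n + 1)

/-- The primitive recursive function defined by a symbol. The first argument of a function defined
by primitive recursion is the recursion variable. -/
def PRSym.eval : {n : ℕ} → PRSym n → (Fin n → ℕ) → ℕ
  | _, .zero, _ => 0
  | _, .succ, v => v 0 + 1
  | _, .proj i, v => v i
  | _, .comp f g, v => f.eval (fun i => (g i).eval v)
  | _, .prec f g, v =>
      Nat.rec (f.eval (Fin.tail v))
        (fun y ih => g.eval (Fin.cons y (Fin.cons ih (Fin.tail v)))) (v 0)

/-- The first-order language whose non-logical symbols are the primitive recursive function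
symbols; identity is a logical symbol. -/
abbrev prLang : FirstOrder.Language := ⟨PRSym, fun _ => Empty⟩

/-- The standard interpretation. -/
instance : prLang.Structure ℕ where
  funMap := fun f v => PRSym.eval f v
  RelMap := fun r _ => Empty.elim r

/-- Terms over the variables `v₀, v₁, v₂, …`. -/
abbrev PRTerm : Type := prLang.Term ℕ

/-- The variable `vᵢ`. -/
abbrev vr (i : ℕ) : PRTerm := FirstOrder.Language.Term.var i

/-- The term `f(t₁, …, tₙ)`. -/
def app {n : ℕ} (f : PRSym n) (ts : Fin n → PRTerm) : PRTerm :=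
  FirstOrder.Language.Term.func (L := prLang) f ts

/-- The term `0`. -/
def zeroT : PRTerm := app .zero ![]

/-- The term `t + 1`. -/
def succT (t : PRTerm) : PRTerm := app .succ ![t]

/-- The numeral of `n`, that is, `n` successor symbols applied to `0`. -/
def numeral : ℕ → PRTerm
  | 0 => zeroT
  | n + 1 => succT (numeral n)

/-- First-order formulas with identity and named variables. The other connectives and the
existential quantifier are abbreviations. -/
inductive Formula : Type
  | eq (s t : PRTerm) : Formula
  | neg (A : Formula) : Formula
  | imp (A B : Formula) : Formula
  | all (x : ℕ) (A : Formula) : Formula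

namespace Formula

/-- `∃ x A` abbreviates `¬ ∀ x ¬ A`. -/
def ex (x : ℕ) (A : Formula) : Formula := neg (all x (neg A))

/-- The variable `x` occurs free in the formula. -/
def Free (x : ℕ) : Formula → Prop
  | eq s t => x ∈ s.varFinset ∨ x ∈ t.varFinset
  | neg A => A.Free x
  | imp A B => A.Free x ∨ B.Free x
  | all y A => x ≠ y ∧ A.Free x

/-- Replacement of the free occurrences of the variable `x` by the term `t`. -/
def subst (x : ℕ) (t : PRTerm) : Formula → Formula
  | eq r s => eq (r.subst (Function.update vr x t)) (s.subst (Function.update vr x t))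
  | neg A => neg (A.subst x t)
  | imp A B => imp (A.subst x t) (B.subst x t)
  | all y A => if x = y then all y A else all y (A.subst x t)

/-- The term `t` is free for the variable `x`: no variable of `t` gets bound by the
substitution. -/
def FreeFor (x : ℕ) (t : PRTerm) : Formula → Prop
  | eq _ _ => True
  | neg A => A.FreeFor x t
  | imp A B => A.FreeFor x t ∧ B.FreeFor x t
  | all y A => ¬ (all y A).Free x ∨ (y ∉ t.varFinset ∧ A.FreeFor x t)

/-- The formula contains no quantifier. -/
def QuantifierFree : Formula → Prop
  | eq _ _ => True
  | neg A => A.QuantifierFree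
  | imp A B => A.QuantifierFree ∧ B.QuantifierFree
  | all _ _ => False

/-- Satisfaction in the standard model under an assignment. -/
def Sat : Formula → (ℕ → ℕ) → Prop
  | eq s t, e => s.realize e = t.realize e
  | neg A, e => ¬ A.Sat e
  | imp A B, e => A.Sat e → B.Sat e
  | all x A, e => ∀ n : ℕ, A.Sat (Function.update e x n)

/-- Truth in the standard model (for sentences the assignment is irrelevant). -/
def IsTrue (A : Formula) : Prop := ∀ e : ℕ → ℕ, A.Sat e

end Formula

/-! ## Gödel numbering -/

/-- Gödel number of a function symbol. -/
def PRSym.code : {n : ℕ} → PRSym n → ℕ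
  | _, .zero => Nat.pair 1 0
  | _, .succ => Nat.pair 2 0
  | _, .proj (n := n) i => Nat.pair 3 (Nat.pair n i)
  | _, .comp (m := m) (n := n) f g =>
      Nat.pair 4 (Nat.pair (Nat.pair m n)
        (Nat.pair f.code (Encodable.encode (List.ofFn fun i => (g i).code))))
  | _, .prec (n := n) f g => Nat.pair 5 (Nat.pair n (Nat.pair f.code g.code))

/-- Gödel number of a term. -/
def termCode : PRTerm → ℕ
  | .var i => Nat.pair 1 i
  | .func (l := n) f ts =>
      Nat.pair 2 (Nat.pair n
        (Nat.pair (PRSym.code f) (Encodable.encode (List.ofFn fun i => termCode (ts i)))))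

/-- Gödel number of a formula. -/
def Formula.code : Formula → ℕ
  | .eq s t => Nat.pair 1 (Nat.pair (termCode s) (termCode t))
  | .neg A => Nat.pair 2 A.code
  | .imp A B => Nat.pair 3 (Nat.pair A.code B.code)
  | .all x A => Nat.pair 4 (Nat.pair x A.code)

/-- Gödel number of a finite sequence of formulas. -/
def seqCode (L : List Formula) : ℕ := Encodable.encode (L.map Formula.code)

/-! ## The usual first-order logic with identity -/

/-- Axioms of a Hilbert calculus for first-order logic with identity. -/
inductive LogicalAxiom : Formula → Prop
  | k (A B : Formula) : LogicalAxiom (A.imp (B.imp A))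
  | s (A B C : Formula) :
      LogicalAxiom ((A.imp (B.imp C)).imp ((A.imp B).imp (A.imp C)))
  | contra (A B : Formula) : LogicalAxiom ((A.neg.imp B.neg).imp (B.imp A))
  | inst (x : ℕ) (t : PRTerm) (A : Formula) (h : A.FreeFor x t) :
      LogicalAxiom ((Formula.all x A).imp (A.subst x t))
  | dist (x : ℕ) (A B : Formula) (h : ¬ A.Free x) :
      LogicalAxiom ((Formula.all x (A.imp B)).imp (A.imp (Formula.all x B)))
  | eqRefl (t : PRTerm) : LogicalAxiom (Formula.eq t t)
  | eqSubst (x : ℕ) (t : PRTerm) (A : Formula) (h : A.FreeFor x t) :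
      LogicalAxiom ((Formula.eq (vr x) t).imp (A.imp (A.subst x t)))

/-- The list `L` is a proof from the non-logical axioms `S`: every line is an axiom, or comes from
earlier lines by modus ponens or generalization. -/
def IsProof (S : Set Formula) (L : List Formula) : Prop :=
  ∀ (i : ℕ) (A : Formula), L[i]? = some A →
    A ∈ S ∨ LogicalAxiom A ∨
    (∃ j k : ℕ, j < i ∧ k < i ∧ ∃ B : Formula, L[j]? = some B ∧ L[k]? = some (B.imp A)) ∨
    (∃ j : ℕ, j < i ∧ ∃ (x : ℕ) (B : Formula), L[j]? = some B ∧ A = Formula.all x B)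

/-- `p` is the Gödel number of a proof in `S` whose last line is `A`. -/
def Proves (S : Set Formula) (p : ℕ) (A : Formula) : Prop :=
  ∃ L : List Formula, seqCode L = p ∧ IsProof S L ∧ L.getLast? = some A

/-- `A` is a theorem of `S`. -/
def Provable (S : Set Formula) (A : Formula) : Prop := ∃ p : ℕ, Proves S p A

/-! ## The systems considered -/

/-- The ordinary defining equations of the primitive recursive function symbols, together with the
axiom that `0` is not a successor (free variables are read universally). -/
inductive BasicAxiom : Formula → Prop
  | succ_ne_zero : BasicAxiom (Formula.neg (Formula.eq (succT (vr 0)) zeroT))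
  | proj {n : ℕ} (i : Fin n) :
      BasicAxiom (Formula.eq (app (.proj i) (fun j : Fin n => vr j)) (vr i))
  | comp {m n : ℕ} (f : PRSym n) (g : Fin n → PRSym m) :
      BasicAxiom (Formula.eq (app (.comp f g) (fun j : Fin m => vr j))
        (app f (fun i => app (g i) (fun j : Fin m => vr j))))
  | prec_zero {n : ℕ} (f : PRSym n) (g : PRSym (n + 2)) :
      BasicAxiom (Formula.eq
        (app (.prec f g) (Fin.cons zeroT (fun j : Fin n => vr j)))
        (app f (fun j : Fin n => vr j)))
  | prec_succ {n : ℕ} (f : PRSym n) (g : PRSym (n + 2)) :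
      BasicAxiom (Formula.eq
        (app (.prec f g) (Fin.cons (succT (vr n)) (fun j : Fin n => vr j)))
        (app g (Fin.cons (vr n)
          (Fin.cons (app (.prec f g) (Fin.cons (vr n) (fun j : Fin n => vr j)))
            (fun j : Fin n => vr j)))))

/-- `S` is a primitive-recursively axiomatized arithmetic: the set of Gödel numbers of its
non-logical axioms is primitive recursive, and it proves the basic axioms. -/
structure IsPRArithmetic (S : Set Formula) : Prop where
  primrec_axioms : PrimrecPred (fun n : ℕ => ∃ A ∈ S, A.code = n)
  proves_basic : ∀ A : Formula, BasicAxiom A → Provable S A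

/-! ## Consistency notions -/

/-- No formula is provable together with its negation. -/
def Consistent (S : Set Formula) : Prop :=
  ¬ ∃ A : Formula, Provable S A ∧ Provable S A.neg

/-- `S` is `ω`-consistent: there is no `A(x)` such that `A(n)` is provable for every numeral `n`
and `¬ ∀ x A(x)` is provable. -/
def OmegaConsistent (S : Set Formula) : Prop :=
  ¬ ∃ (x : ℕ) (A : Formula), (∀ z : ℕ, A.Free z → z = x) ∧
    (∀ n : ℕ, Provable S (A.subst x (numeral n))) ∧ Provable S (Formula.all x A).neg

/-- `A` is a quantifier-free formula with at most the variable `x`, so that `∃ x A` is a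
`Σ⁰₁` sentence. -/
structure IsSigmaOneMatrix (x : ℕ) (A : Formula) : Prop where
  quantifierFree : A.QuantifierFree
  free : ∀ z : ℕ, A.Free z → z = x

/-- `A` is a quantifier-free formula with at most the distinct variables `x` and `y`, so that
`∀ x ∃ y A` is a `Π⁰₂` sentence and `∃ x ∀ y A` is a `Σ⁰₂` sentence. -/
structure IsTwoMatrix (x y : ℕ) (A : Formula) : Prop where
  ne : x ≠ y
  quantifierFree : A.QuantifierFree
  free : ∀ z : ℕ, A.Free z → z = x ∨ z = y

/-- `S` is `1`-consistent: for no `Σ⁰₁` sentence `∃ x A(x)` is it the case that `∃ x A(x)` and all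
of `¬ A(n)` are provable. -/
def OneConsistent (S : Set Formula) : Prop :=
  ¬ ∃ (x : ℕ) (A : Formula), IsSigmaOneMatrix x A ∧
    Provable S (Formula.ex x A) ∧ ∀ n : ℕ, Provable S (A.subst x (numeral n)).neg

/-- `S` is `Σ⁰₁`-correct: every provable `Σ⁰₁` sentence is true. -/
def SigmaOneCorrect (S : Set Formula) : Prop :=
  ∀ (x : ℕ) (A : Formula), IsSigmaOneMatrix x A →
    Provable S (Formula.ex x A) → (Formula.ex x A).IsTrue

/-- `S` is `2`-consistent: for no `Σ⁰₂` sentence `∃ x ∀ y A(x, y)` is it the case that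
`∃ x ∀ y A(x, y)` and all of `¬ ∀ y A(n, y)` are provable. -/
def TwoConsistent (S : Set Formula) : Prop :=
  ¬ ∃ (x y : ℕ) (A : Formula), IsTwoMatrix x y A ∧
    Provable S (Formula.ex x (Formula.all y A)) ∧
    ∀ n : ℕ, Provable S ((Formula.all y A).subst x (numeral n)).neg

/-! ## The sentence -/

/-- `p` is the Gödel number of a proof of a `Π⁰₂` sentence `∀ x ∃ y A(x, y)`. -/
def ProvesPiTwo (S : Set Formula) (p : ℕ) : Prop :=
  ∃ (x y : ℕ) (A : Formula), IsTwoMatrix x y A ∧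
    Proves S p (Formula.all x (Formula.ex y A))

/-- `p` proves a `Π⁰₂` sentence `∀ x ∃ y A(x, y)` and `q` proves an instance `A(p, n)`, for some
numeral `n`. -/
def ProvesInstance (S : Set Formula) (p q : ℕ) : Prop :=
  ∃ (x y : ℕ) (A : Formula), IsTwoMatrix x y A ∧
    Proves S p (Formula.all x (Formula.ex y A)) ∧
    ∃ n : ℕ, Proves S q ((A.subst x (numeral p)).subst y (numeral n))

/-- The symbol `f` defines the predicate `p proves a Π⁰₂ sentence`, in the form `f(p) = 1`. -/
def DefinesProvesPiTwo (S : Set Formula) (f : PRSym 1) : Prop :=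
  ∀ p : ℕ, f.eval ![p] = 1 ↔ ProvesPiTwo S p

/-- The symbol `g` defines the relation `q proves an instance of the Π⁰₂ sentence proved by p`, in
the form `g(p, q) = 1`. -/
def DefinesProvesInstance (S : Set Formula) (g : PRSym 2) : Prop :=
  ∀ p q : ℕ, g.eval ![p, q] = 1 ↔ ProvesInstance S p q

/-- The quantifier-free conditional `f(s) = 1 → g(s, t) = 1`. -/
def starMatrix (f : PRSym 1) (g : PRSym 2) (s t : PRTerm) : Formula :=
  (Formula.eq (app f ![s]) (numeral 1)).imp (Formula.eq (app g ![s, t]) (numeral 1))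

/-- The `Π⁰₂` sentence `∀ x ∃ y (f(x) = 1 → g(x, y) = 1)`. -/
def starSentence (f : PRSym 1) (g : PRSym 2) : Formula :=
  Formula.all 0 (Formula.ex 1 (starMatrix f g (vr 0) (vr 1)))

/-- The numerical instance `∃ y (f(m) = 1 → g(m, y) = 1)` of the sentence. -/
def starInstance (f : PRSym 1) (g : PRSym 2) (m : ℕ) : Formula :=
  Formula.ex 1 (starMatrix f g (numeral m) (vr 1))

end PRArith

open PRArith

/-! The engine is that `S` decides every closed quantifier-free formula in accordance with its truth
value (`provable_of_sat`). This rests on `provable_eval`, by which `S` computes each function symbol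
on numerals, and on `provable_numeral_ne`. Hence true `Σ⁰₁` sentences are provable. A provable but
false one has all its instances refuted, which violates 1-consistency; conversely, a violation of
1-consistency together with `Σ⁰₁`-correctness makes `S` inconsistent and so able to prove a false
`Σ⁰₁` sentence.

If `S` is 1-consistent and `p` proves `∀x∃yA`, then `∃yA(p,y)` is provable, hence true, hence has a
true instance, which is provable. So `(***)` is true. In an inconsistent system any instance has a
proof.

Unprovability needs no fixed point: the number of an assumed proof plays the diagonal role. Let `p`
prove `(***)`, and let `q` prove an instance at `p`, with second numeral `n`. The numeral is part of
the formula and the formula is part of the proof, so `n < q`. The instance asserts `f(p) = 1 →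
g(p,n) = 1`, and `f(p) = 1` holds. If `g(p,n) = 1` failed, `S` would also refute the instance; by
consistency, `n` is itself a proof of an instance at `p`. This is an infinite descent, so no proof
of an instance at `p` exists, contrary to the truth of `(***)`. The argument is
`not_provable_starSentence`.

Irrefutability under 2-consistency follows because every numerical instance is a true `Σ⁰₁` sentence
and so provable, while the negation of `(***)` is literally a `Σ⁰₂` sentence. `ω`-consistency
implies 2-consistency, which implies 1-consistency.

The symbols `f` and `g` come from arithmetizing syntax. Operations on codes are defined by
course-of-values recursion (`primrec_courseRec`), and unbounded searches become bounded because
subexpressions have smaller codes (`Formula.Free.termCode_le_subst`, `Proves.code_lt`). The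
resulting characterizations are `provesPiTwoCode_iff` and `provesInstanceCode_iff`. -/

namespace PRArith

open FirstOrder.Language

attribute [fun_prop] Primrec

variable {S : Set Formula} {A B C : Formula}

/-! ## Closure properties of provability -/

theorem IsProof.append {L M : List Formula} (hL : IsProof S L) (hM : IsProof S M) :
    IsProof S (L ++ M) := by
  intro i A h
  rcases lt_or_ge i L.length with hi | hi
  · rw [List.getElem?_append_left hi] at h
    rcases hL i A h with h | h | ⟨j, k, hj, hk, B, h1, h2⟩ | ⟨j, hj, x, B, h1, h2⟩
    · exact .inl h
    · exact .inr (.inl h)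
    · refine .inr (.inr (.inl ⟨j, k, hj, hk, B, ?_, ?_⟩))
      · rwa [List.getElem?_append_left (hj.trans hi)]
      · rwa [List.getElem?_append_left (hk.trans hi)]
    · refine .inr (.inr (.inr ⟨j, hj, x, B, ?_, h2⟩))
      rwa [List.getElem?_append_left (hj.trans hi)]
  · rw [List.getElem?_append_right hi] at h
    rcases hM _ A h with h | h | ⟨j, k, hj, hk, B, h1, h2⟩ | ⟨j, hj, x, B, h1, h2⟩
    · exact .inl h
    · exact .inr (.inl h)
    · refine .inr (.inr (.inl ⟨L.length + j, L.length + k, by omega, by omega, B, ?_, ?_⟩))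
      · rwa [List.getElem?_append_right (by omega), Nat.add_sub_cancel_left]
      · rwa [List.getElem?_append_right (by omega), Nat.add_sub_cancel_left]
    · refine .inr (.inr (.inr ⟨L.length + j, by omega, x, B, ?_, h2⟩))
      rwa [List.getElem?_append_right (by omega), Nat.add_sub_cancel_left]

theorem IsProof.concat {L : List Formula} (hL : IsProof S L)
    (h : A ∈ S ∨ LogicalAxiom A ∨ (∃ B, B ∈ L ∧ B.imp A ∈ L) ∨
      ∃ (x : ℕ) (B : Formula), B ∈ L ∧ A = Formula.all x B) :
    IsProof S (L ++ [A]) := by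
  intro i C hC
  rcases lt_trichotomy i L.length with hi | rfl | hi
  · rw [List.getElem?_append_left hi] at hC
    rcases hL i C hC with h | h | ⟨j, k, hj, hk, B, h1, h2⟩ | ⟨j, hj, x, B, h1, h2⟩
    · exact .inl h
    · exact .inr (.inl h)
    · refine .inr (.inr (.inl ⟨j, k, hj, hk, B, ?_, ?_⟩))
      · rwa [List.getElem?_append_left (hj.trans hi)]
      · rwa [List.getElem?_append_left (hk.trans hi)]
    · refine .inr (.inr (.inr ⟨j, hj, x, B, ?_, h2⟩))
      rwa [List.getElem?_append_left (hj.trans hi)]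
  · obtain rfl : A = C := by simpa using hC
    have key : ∀ B ∈ L, ∃ j < L.length, (L ++ [A])[j]? = some B := by
      intro B hB
      obtain ⟨j, hj, rfl⟩ := List.getElem_of_mem hB
      exact ⟨j, hj, by rw [List.getElem?_append_left hj, List.getElem?_eq_getElem hj]⟩
    rcases h with h | h | ⟨B, h1, h2⟩ | ⟨x, B, h1, h2⟩
    · exact .inl h
    · exact .inr (.inl h)
    · obtain ⟨j, hj, h1⟩ := key _ h1
      obtain ⟨k, hk, h2⟩ := key _ h2
      exact .inr (.inr (.inl ⟨j, k, hj, hk, B, h1, h2⟩))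
    · obtain ⟨j, hj, h1⟩ := key _ h1
      exact .inr (.inr (.inr ⟨j, hj, x, B, h1, h2⟩))
  · rw [List.getElem?_eq_none (by simp; omega)] at hC
    cases hC

theorem provable_iff : Provable S A ↔ ∃ L, IsProof S L ∧ L.getLast? = some A :=
  ⟨fun ⟨_, L, _, h⟩ => ⟨L, h⟩, fun ⟨L, h⟩ => ⟨_, L, rfl, h⟩⟩

theorem isProof_nil : IsProof S [] := by
  intro i A h
  simp at h

theorem Provable.logical (h : LogicalAxiom A) : Provable S A :=
  provable_iff.2 ⟨[] ++ [A], isProof_nil.concat (.inr (.inl h)), by simp⟩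

theorem Provable.mp (h₁ : Provable S (A.imp B)) (h₂ : Provable S A) : Provable S B := by
  obtain ⟨L, hL, hL'⟩ := provable_iff.1 h₁
  obtain ⟨M, hM, hM'⟩ := provable_iff.1 h₂
  refine provable_iff.2 ⟨L ++ M ++ [B], (hL.append hM).concat (.inr (.inr (.inl ⟨A, ?_, ?_⟩))),
    by simp⟩
  · exact List.mem_append_right _ (List.mem_of_getLast? hM')
  · exact List.mem_append_left _ (List.mem_of_getLast? hL')

theorem Provable.gen (x : ℕ) (h : Provable S A) : Provable S (Formula.all x A) := by
  obtain ⟨L, hL, hL'⟩ := provable_iff.1 h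
  exact provable_iff.2 ⟨L ++ [Formula.all x A],
    hL.concat (.inr (.inr (.inr ⟨x, A, List.mem_of_getLast? hL', rfl⟩))), by simp⟩

theorem Provable.inst {x : ℕ} {t : PRTerm} (h : Provable S (Formula.all x A))
    (ht : A.FreeFor x t) : Provable S (A.subst x t) :=
  (Provable.logical (.inst x t A ht)).mp h

/-! ## Propositional derivations -/

/-- Derivability from the formulas of `T` by propositional logic. -/
inductive PropDerivable (T : Set Formula) : Formula → Prop
  | mem {A : Formula} (h : A ∈ T) : PropDerivable T A
  | k (A B : Formula) : PropDerivable T (A.imp (B.imp A))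
  | s (A B C : Formula) :
      PropDerivable T ((A.imp (B.imp C)).imp ((A.imp B).imp (A.imp C)))
  | contra (A B : Formula) : PropDerivable T ((A.neg.imp B.neg).imp (B.imp A))
  | mp {A B : Formula} (h₁ : PropDerivable T (A.imp B)) (h₂ : PropDerivable T A) :
      PropDerivable T B

namespace PropDerivable

variable {T T' : Set Formula}

theorem mono (hT : T ⊆ T') (h : PropDerivable T A) : PropDerivable T' A := by
  induction h with
  | mem h => exact .mem (hT h)
  | k A B => exact .k A B
  | s A B C => exact .s A B C
  | contra A B => exact .contra A B
  | mp _ _ ih₁ ih₂ => exact .mp ih₁ ih₂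

/-- Generalization is not a rule of this auxiliary calculus, so the deduction theorem holds without
any condition on free variables. -/
theorem deduction (h : PropDerivable (insert A T) B) : PropDerivable T (A.imp B) := by
  induction h with
  | @mem B h =>
    rcases h with rfl | h
    · exact ((s B (B.imp B) B).mp (k _ _)).mp (k _ _)
    · exact (k _ _).mp (mem h)
  | k A B => exact (k _ _).mp (k A B)
  | s A B C => exact (k _ _).mp (s A B C)
  | contra A B => exact (k _ _).mp (contra A B)
  | mp _ _ ih₁ ih₂ => exact ((s _ _ _).mp ih₁).mp ih₂

theorem absurd (h₁ : PropDerivable T A) (h₂ : PropDerivable T A.neg) : PropDerivable T B :=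
  ((contra _ _).mp ((k _ _).mp h₂)).mp h₁

theorem of_neg_neg (h : PropDerivable T A.neg.neg) : PropDerivable T A := by
  refine ((contra A A.neg.neg).mp (deduction ?_)).mp h
  exact absurd (mem (Set.mem_insert _ _)) (h.mono (Set.subset_insert _ _))

theorem neg_intro (h₁ : PropDerivable (insert A T) B) (h₂ : PropDerivable (insert A T) B.neg) :
    PropDerivable T A.neg := by
  -- Contraposition against the tautology `A → A`: it suffices that `¬¬A` implies its negation.
  refine ((contra A.neg (A.imp A)).mp (deduction ?_)).mp (deduction (mem (Set.mem_insert _ _)))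
  have hA : PropDerivable (insert A.neg.neg T) A := of_neg_neg (mem (Set.mem_insert _ _))
  exact absurd ((h₁.deduction.mono (Set.subset_insert _ _)).mp hA)
    ((h₂.deduction.mono (Set.subset_insert _ _)).mp hA)

/-- Taking the theorems of `S` as hypotheses transfers every propositional derivation, found with
the deduction theorem, back to the Hilbert calculus. -/
theorem provable (h : PropDerivable {A | Provable S A} B) : Provable S B := by
  induction h with
  | mem h => exact h
  | k A B => exact .logical (.k A B)
  | s A B C => exact .logical (.s A B C)
  | contra A B => exact .logical (.contra A B)
  | mp _ _ ih₁ ih₂ => exact ih₁.mp ih₂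

end PropDerivable

namespace Provable

open PropDerivable

theorem absurd (h₁ : Provable S A) (h₂ : Provable S A.neg) : Provable S B :=
  (PropDerivable.absurd (.mem h₁) (.mem h₂)).provable

theorem imp_of_right (h : Provable S B) : Provable S (A.imp B) :=
  (Provable.logical (.k B A)).mp h

theorem imp_of_neg (h : Provable S A.neg) : Provable S (A.imp B) :=
  (deduction (PropDerivable.absurd (.mem (Set.mem_insert _ _))
    (.mem (Set.mem_insert_of_mem _ h)))).provable

theorem neg_of_imp_neg (h : Provable S (A.imp B.neg)) (hB : Provable S B) : Provable S A.neg :=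
  (neg_intro (B := B) (.mem (Set.mem_insert_of_mem _ hB))
    (.mp (.mem (Set.mem_insert_of_mem _ h)) (.mem (Set.mem_insert _ _)))).provable

theorem mt (h : Provable S (A.imp B)) (hB : Provable S B.neg) : Provable S A.neg :=
  (neg_intro (B := B) (.mp (.mem (Set.mem_insert_of_mem _ h)) (.mem (Set.mem_insert _ _)))
    (.mem (Set.mem_insert_of_mem _ hB))).provable

theorem contrapose (h : Provable S (A.imp B)) : Provable S (B.neg.imp A.neg) :=
  (deduction (neg_intro (B := B)
    (.mp (.mem (Set.mem_insert_of_mem _ (Set.mem_insert_of_mem _ h))) (.mem (Set.mem_insert _ _)))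
    (.mem (Set.mem_insert_of_mem _ (Set.mem_insert _ _))))).provable

theorem neg_neg (h : Provable S A) : Provable S A.neg.neg :=
  (neg_intro (B := A) (.mem (Set.mem_insert_of_mem _ h)) (.mem (Set.mem_insert _ _))).provable

theorem neg_imp (h₁ : Provable S A) (h₂ : Provable S B.neg) : Provable S (A.imp B).neg :=
  (neg_intro (B := B) (.mp (.mem (Set.mem_insert _ _)) (.mem (Set.mem_insert_of_mem _ h₁)))
    (.mem (Set.mem_insert_of_mem _ h₂))).provable

theorem trans (h₁ : Provable S (A.imp B)) (h₂ : Provable S (B.imp C)) : Provable S (A.imp C) :=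
  (deduction (.mp (.mem (Set.mem_insert_of_mem _ h₂))
    (.mp (.mem (Set.mem_insert_of_mem _ h₁)) (.mem (Set.mem_insert _ _))))).provable

theorem imp_mp (h₁ : Provable S (A.imp (B.imp C))) (h₂ : Provable S B) : Provable S (A.imp C) :=
  ((Provable.logical (.s A B C)).mp h₁).mp h₂.imp_of_right

end Provable

/-! ## Terms and substitution -/

/-- The term contains no variable. -/
def ClosedTerm (t : PRTerm) : Prop := t.varFinset = ∅

theorem mem_varFinset_app {n : ℕ} {f : PRSym n} {ts : Fin n → PRTerm} {x : ℕ} :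
    x ∈ (app f ts).varFinset ↔ ∃ i, x ∈ (ts i).varFinset := by
  simp [app, Term.varFinset]

theorem mem_varFinset_var {x y : ℕ} : x ∈ (vr y).varFinset ↔ x = y := by
  simp [Term.varFinset]

theorem closedTerm_app {n : ℕ} {f : PRSym n} {ts : Fin n → PRTerm} :
    ClosedTerm (app f ts) ↔ ∀ i, ClosedTerm (ts i) := by
  simp only [ClosedTerm, Finset.eq_empty_iff_forall_notMem, mem_varFinset_app]
  exact ⟨fun h i x hx => h x ⟨i, hx⟩, fun h x ⟨i, hx⟩ => h i x hx⟩

theorem closedTerm_zeroT : ClosedTerm zeroT := closedTerm_app.2 fun i => i.elim0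

theorem closedTerm_succT {t : PRTerm} (h : ClosedTerm t) : ClosedTerm (succT t) :=
  closedTerm_app.2 fun i => by simpa using h

theorem closedTerm_numeral (n : ℕ) : ClosedTerm (numeral n) := by
  induction n with
  | zero => exact closedTerm_zeroT
  | succ n ih => exact closedTerm_succT ih

theorem subst_app {n : ℕ} (f : PRSym n) (ts : Fin n → PRTerm) (σ : ℕ → PRTerm) :
    (app f ts).subst σ = app f fun i => (ts i).subst σ := rfl

theorem subst_var (x : ℕ) (σ : ℕ → PRTerm) : (vr x).subst σ = σ x := rfl

theorem term_subst_congr {t : PRTerm} {σ τ : ℕ → PRTerm}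
    (h : ∀ x ∈ t.varFinset, σ x = τ x) : t.subst σ = t.subst τ := by
  induction t with
  | var i => exact h i (mem_varFinset_var.2 rfl)
  | func f ts ih =>
    refine congrArg (Term.func f) (funext fun i => ih i fun x hx => h x ?_)
    exact mem_varFinset_app.2 ⟨i, hx⟩

theorem term_subst_vr (t : PRTerm) : t.subst vr = t := by
  induction t with
  | var i => rfl
  | func f ts ih => exact congrArg (Term.func f) (funext ih)

theorem ClosedTerm.subst_eq {t : PRTerm} (h : ClosedTerm t) (σ : ℕ → PRTerm) :
    t.subst σ = t := by
  rw [← term_subst_congr (σ := vr), term_subst_vr]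
  simp [show t.varFinset = ∅ from h]

theorem term_subst_subst (t : PRTerm) (σ τ : ℕ → PRTerm) :
    (t.subst σ).subst τ = t.subst fun x => (σ x).subst τ := by
  induction t with
  | var i => rfl
  | func f ts ih => exact congrArg (Term.func f) (funext ih)

theorem realize_app {n : ℕ} (f : PRSym n) (ts : Fin n → PRTerm) (e : ℕ → ℕ) :
    (app f ts).realize e = f.eval fun i => (ts i).realize e := rfl

theorem realize_numeral (n : ℕ) (e : ℕ → ℕ) : (numeral n).realize e = n := by
  induction n with
  | zero => rfl
  | succ n ih => exact congrArg (· + 1) ih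

theorem realize_subst_update (t r : PRTerm) (x : ℕ) (e : ℕ → ℕ) :
    (r.subst (Function.update vr x t)).realize e =
      r.realize (Function.update e x (t.realize e)) := by
  rw [Term.realize_subst]
  congr 1
  ext i
  by_cases h : i = x
  · subst h; simp
  · simp [h]

/-! ## Identity between closed terms -/

/-- The identity axiom has a variable on its left side; generalizing over that variable and
instantiating it by `s` gives the form with terms on both sides. Closedness of `t` keeps the second
substitution from changing the copies of `t` already inserted. -/
theorem provable_eq_subst (s : PRTerm) {t : PRTerm} (ht : ClosedTerm t) (x : ℕ)
    (r₁ r₂ : PRTerm) :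
    Provable S ((Formula.eq s t).imp ((((Formula.eq r₁ r₂).subst x s)).imp
      ((Formula.eq r₁ r₂).subst x t))) := by
  have h := ((Provable.logical (S := S)
    (.eqSubst x t (Formula.eq r₁ r₂) trivial)).gen x).inst (t := s) (by simp [Formula.FreeFor,
      Formula.subst])
  have key : ∀ r : PRTerm, (r.subst (Function.update vr x t)).subst (Function.update vr x s) =
      r.subst (Function.update vr x t) := by
    intro r
    rw [term_subst_subst]
    refine term_subst_congr fun y _ => ?_
    by_cases hy : y = x
    · subst hy; simp [ht.subst_eq]
    · simp [hy]
  simpa [Formula.subst, key, ht.subst_eq, subst_var] using h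

theorem provable_eq_refl (t : PRTerm) : Provable S (Formula.eq t t) := .logical (.eqRefl t)

theorem provable_eq_symm {s t : PRTerm} (hs : ClosedTerm s) (ht : ClosedTerm t)
    (h : Provable S (Formula.eq s t)) : Provable S (Formula.eq t s) := by
  have := provable_eq_subst (S := S) s ht 0 (vr 0) s
  simp only [Formula.subst, subst_var, Function.update_self, hs.subst_eq] at this
  exact (this.mp h).mp (provable_eq_refl s)

theorem provable_eq_trans_imp {s t : PRTerm} (r : PRTerm) (hr : ClosedTerm r)
    (ht : ClosedTerm t) :
    Provable S ((Formula.eq s t).imp ((Formula.eq r s).imp (Formula.eq r t))) := by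
  have := provable_eq_subst (S := S) s ht 0 r (vr 0)
  simpa only [Formula.subst, subst_var, Function.update_self, hr.subst_eq] using this

theorem provable_eq_trans {r s t : PRTerm} (hr : ClosedTerm r) (ht : ClosedTerm t)
    (h₁ : Provable S (Formula.eq r s)) (h₂ : Provable S (Formula.eq s t)) :
    Provable S (Formula.eq r t) :=
  ((provable_eq_trans_imp r hr ht).mp h₂).mp h₁

/-- Replacement of equals acts on one argument at a time, so the induction runs over the set of
places already replaced. -/
theorem provable_eq_app {n : ℕ} (f : PRSym n) {ts us : Fin n → PRTerm}
    (hts : ∀ i, ClosedTerm (ts i)) (hus : ∀ i, ClosedTerm (us i))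
    (h : ∀ i, Provable S (Formula.eq (ts i) (us i))) :
    Provable S (Formula.eq (app f ts) (app f us)) := by
  classical
  have key : ∀ I : Finset (Fin n),
      Provable S (Formula.eq (app f ts) (app f (I.piecewise us ts))) := by
    intro I
    induction I using Finset.induction_on with
    | empty => simpa using provable_eq_refl (app f ts)
    | insert i I hi ih =>
      have hcl : ∀ j, ClosedTerm (I.piecewise us ts j) := by
        intro j
        by_cases hj : j ∈ I
        · simpa [hj] using hus j
        · simpa [hj] using hts j
      have hsub : ∀ t : PRTerm, (app f (Function.update (I.piecewise us ts) i (vr 0))).subst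
          (Function.update vr 0 t) = app f (Function.update (I.piecewise us ts) i t) := by
        intro t
        rw [subst_app]
        congr 1
        ext1 j
        by_cases hj : j = i
        · subst hj; simp
        · simp [hj, (hcl j).subst_eq]
      have h1 := provable_eq_subst (S := S) (ts i) (hus i) 0 (app f ts)
        (app f (Function.update (I.piecewise us ts) i (vr 0)))
      have hup : Function.update (I.piecewise us ts) i (ts i) = I.piecewise us ts := by
        rw [Function.update_eq_self_iff]; simp [hi]
      simp only [Formula.subst, hsub, (closedTerm_app.2 hts).subst_eq, hup] at h1
      rw [Finset.piecewise_insert]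
      exact (h1.mp (h i)).mp ih
  simpa using key Finset.univ

/-- Simultaneous substitution is obtained by instantiating `v₀, v₁, …` in turn. The terms inserted
are closed, so later steps do not disturb them, and only finitely many variables occur. -/
theorem provable_eq_instance {s t : PRTerm} (h : Provable S (Formula.eq s t)) (σ : ℕ → PRTerm)
    (hσ : ∀ i, ClosedTerm (σ i)) : Provable S (Formula.eq (s.subst σ) (t.subst σ)) := by
  have key : ∀ k, Provable S (Formula.eq (s.subst fun i => if i < k then σ i else vr i)
      (t.subst fun i => if i < k then σ i else vr i)) := by
    intro k
    induction k with
    | zero =>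
      have : (fun i => if i < 0 then σ i else vr i) = vr := by ext1 i; simp
      rwa [this, term_subst_vr, term_subst_vr]
    | succ k ih =>
      have h1 := (ih.gen k).inst (t := σ k) trivial
      have : (fun x => (if x < k then σ x else vr x).subst (Function.update vr k (σ k))) =
          fun i => if i < k + 1 then σ i else vr i := by
        ext1 i
        rcases lt_trichotomy i k with hi | rfl | hi
        · simp [hi, (hσ i).subst_eq, Nat.lt_succ_of_lt hi]
        · simp
        · simp [hi.not_gt, hi.ne', show ¬ i < k + 1 by omega]
      simpa only [Formula.subst, term_subst_subst, this] using h1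
  obtain ⟨k, hk⟩ : ∃ k, ∀ x ∈ s.varFinset ∪ t.varFinset, x < k :=
    ⟨_, fun x hx => Nat.lt_succ_of_le (Finset.le_sup (f := id) hx)⟩
  have hc : ∀ r : PRTerm, r.varFinset ⊆ s.varFinset ∪ t.varFinset →
      (r.subst fun i => if i < k then σ i else vr i) = r.subst σ := fun r hr =>
    term_subst_congr fun x hx => by simp [hk x (hr hx)]
  have := key k
  rwa [hc s Finset.subset_union_left, hc t Finset.subset_union_right] at this

/-! ## Numerical evaluation -/

/-- The assignment of closed terms to variables given by a finite sequence. -/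
def seqSubst {n : ℕ} (v : Fin n → PRTerm) (i : ℕ) : PRTerm :=
  if h : i < n then v ⟨i, h⟩ else zeroT

theorem seqSubst_val {n : ℕ} (v : Fin n → PRTerm) (i : Fin n) : seqSubst v i = v i := by
  simp [seqSubst]

theorem closedTerm_seqSubst {n : ℕ} {v : Fin n → PRTerm} (hv : ∀ i, ClosedTerm (v i)) (i : ℕ) :
    ClosedTerm (seqSubst v i) := by
  unfold seqSubst
  split
  · exact hv _
  · exact closedTerm_zeroT

theorem subst_zeroT (σ : ℕ → PRTerm) : zeroT.subst σ = zeroT := closedTerm_zeroT.subst_eq σ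

theorem subst_succT (t : PRTerm) (σ : ℕ → PRTerm) : (succT t).subst σ = succT (t.subst σ) := by
  unfold succT
  rw [subst_app]
  congr 1
  ext1 i
  simp

theorem subst_cons {n : ℕ} (t : PRTerm) (ts : Fin n → PRTerm) (σ : ℕ → PRTerm) :
    (fun i => (Fin.cons (α := fun _ => PRTerm) t ts i).subst σ) =
      Fin.cons (α := fun _ => PRTerm) (t.subst σ) fun i => (ts i).subst σ := by
  ext1 i
  refine Fin.cases ?_ (fun i => ?_) i <;> simp

theorem numeral_cons {n : ℕ} (a : ℕ) (v : Fin n → ℕ) :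
    (fun i => numeral (Fin.cons (α := fun _ => ℕ) a v i)) =
      Fin.cons (α := fun _ => PRTerm) (numeral a) fun i => numeral (v i) := by
  ext1 i
  refine Fin.cases ?_ (fun i => ?_) i <;> simp

/-- Induction on the definition of the symbol, with an inner induction on the recursion argument
carried out in the metatheory; `S` itself needs no induction axiom. Zero and successor have no
defining equations because both sides are then the same term. -/
theorem provable_eval (hS : ∀ A, BasicAxiom A → Provable S A) {n : ℕ} (f : PRSym n)
    (v : Fin n → ℕ) :
    Provable S (Formula.eq (app f fun i => numeral (v i)) (numeral (f.eval v))) := by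
  have num := closedTerm_numeral
  induction f with
  | zero =>
    have : (fun i => numeral (v i)) = ![] := Subsingleton.elim _ _
    rw [this]
    exact provable_eq_refl zeroT
  | succ =>
    have : (fun i => numeral (v i)) = ![numeral (v 0)] := by ext1 i; simp [Subsingleton.elim i 0]
    rw [this]
    exact provable_eq_refl (succT (numeral (v 0)))
  | proj i =>
    have := provable_eq_instance (hS _ (.proj i)) (seqSubst fun j => numeral (v j))
      (closedTerm_seqSubst fun j => num _)
    simp only [subst_app, subst_var, seqSubst_val] at this
    exact this
  | comp f g ihf ihg =>
    have := provable_eq_instance (hS _ (.comp f g)) (seqSubst fun j => numeral (v j))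
      (closedTerm_seqSubst fun j => num _)
    simp only [subst_app, subst_var, seqSubst_val] at this
    have hcl : ∀ i, ClosedTerm (app (g i) fun j => numeral (v j)) := fun i =>
      closedTerm_app.2 fun j => num _
    refine provable_eq_trans (closedTerm_app.2 fun j => num _) (num _) this ?_
    exact provable_eq_trans (closedTerm_app.2 hcl) (num _)
      (provable_eq_app f hcl (fun j => num _) fun i => ihg i v) (ihf _)
  | @prec n f g ihf ihg =>
    obtain ⟨a, w, rfl⟩ : ∃ (a : ℕ) (w : Fin n → ℕ), v = Fin.cons a w :=
      ⟨v 0, Fin.tail v, (Fin.cons_self_tail v).symm⟩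
    have hcons : ∀ {m : ℕ} {t : PRTerm} {ts : Fin m → PRTerm}, ClosedTerm t →
        (∀ i, ClosedTerm (ts i)) → ∀ i, ClosedTerm (Fin.cons (α := fun _ => PRTerm) t ts i) := by
      intro m t ts h1 h2 i
      refine Fin.cases ?_ (fun i => ?_) i <;> simp [h1, h2]
    rw [numeral_cons]
    induction a with
    | zero =>
      have := provable_eq_instance (hS _ (.prec_zero f g)) (seqSubst fun j => numeral (w j))
        (closedTerm_seqSubst fun j => num _)
      simp only [subst_app, subst_cons, subst_zeroT, subst_var, seqSubst_val] at this
      exact provable_eq_trans (closedTerm_app.2 (hcons (num _) fun j => num _))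
        (num _) this (ihf w)
    | succ a ih =>
      -- In this axiom the parameters are `v₀, …, vₙ₋₁` and the recursion variable is `vₙ`; hence
      -- `a` is appended at the end, although it is the first argument of the function.
      have := provable_eq_instance (hS _ (.prec_succ f g))
        (seqSubst (Fin.snoc (α := fun _ => PRTerm) (fun j => numeral (w j)) (numeral a)))
        (closedTerm_seqSubst fun j => by
          refine Fin.lastCases ?_ (fun i => ?_) j <;> simp [num])
      have e1 : ∀ j : Fin n, seqSubst (Fin.snoc (α := fun _ => PRTerm) (fun j => numeral (w j))
          (numeral a)) (j : ℕ) = numeral (w j) := fun j => by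
        have := seqSubst_val (Fin.snoc (α := fun _ => PRTerm) (fun j => numeral (w j))
          (numeral a)) j.castSucc
        simpa using this
      have e2 : seqSubst (Fin.snoc (α := fun _ => PRTerm) (fun j => numeral (w j))
          (numeral a)) n = numeral a := by
        have := seqSubst_val (Fin.snoc (α := fun _ => PRTerm) (fun j => numeral (w j))
          (numeral a)) (Fin.last n)
        simpa using this
      simp only [subst_app, subst_cons, subst_succT, subst_var, e1, e2] at this
      have c1 := closedTerm_app (f := PRSym.prec f g).2
        (hcons (num a) fun j => num (w j))
      refine provable_eq_trans (closedTerm_app.2 (hcons (num (a + 1)) fun j => num _))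
        (num _) this ?_
      refine provable_eq_trans (closedTerm_app.2 (hcons (num _) (hcons c1 fun j => num _)))
        (num _) (provable_eq_app g (hcons (num _) (hcons c1 fun j => num _)) (hcons (num a)
          (hcons (num ((PRSym.prec f g).eval (Fin.cons a w))) fun j => num (w j))) fun i => ?_) ?_
      · refine Fin.cases ?_ (fun i => Fin.cases ?_ (fun i => ?_) i) i
        · exact provable_eq_refl _
        · exact ih
        · exact provable_eq_refl _
      · have := ihg (Fin.cons a (Fin.cons ((PRSym.prec f g).eval (Fin.cons a w)) w))
        rwa [numeral_cons, numeral_cons] at this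

/-- The symbol of the predecessor function. -/
def predSym : PRSym 1 := .prec .zero (.proj 0)

theorem provable_pred (hS : ∀ A, BasicAxiom A → Provable S A) (n : ℕ) :
    Provable S (Formula.eq (app predSym ![numeral (n + 1)]) (numeral n)) := by
  have := provable_eval hS predSym ![n + 1]
  have e : (fun i => numeral (![n + 1] i)) = ![numeral (n + 1)] := by
    ext1 i; simp [Subsingleton.elim i 0]
  rw [e] at this
  exact this

/-- Injectivity of the successor is not among the basic axioms. Successors are cancelled by applying
the predecessor symbol to both sides, until one side is `0` and the axiom on `0` applies. -/
theorem provable_numeral_ne (hS : ∀ A, BasicAxiom A → Provable S A) {m n : ℕ} (h : m ≠ n) :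
    Provable S (Formula.neg (Formula.eq (numeral m) (numeral n))) := by
  have num := closedTerm_numeral
  have hz : ∀ m, Provable S (Formula.neg (Formula.eq (numeral (m + 1)) (numeral 0))) := by
    intro m
    have := ((hS _ .succ_ne_zero).gen 0).inst (t := numeral m) trivial
    simp only [Formula.subst, subst_succT, subst_zeroT, subst_var, Function.update_self] at this
    exact this
  induction m generalizing n with
  | zero =>
    obtain ⟨n, rfl⟩ := Nat.exists_eq_succ_of_ne_zero h.symm
    have := provable_eq_subst (S := S) (numeral 0) (num (n + 1)) 0 (vr 0) (numeral 0)
    simp only [Formula.subst, subst_var, Function.update_self, (num 0).subst_eq] at this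
    exact (this.imp_mp (provable_eq_refl _)).mt (hz n)
  | succ m ih =>
    cases n with
    | zero => exact hz m
    | succ n =>
      have hp : ∀ k, ClosedTerm (app predSym ![numeral k]) := fun k =>
        closedTerm_app.2 fun i => by simpa using num k
      have h1 := provable_eq_subst (S := S) (numeral (m + 1)) (num (n + 1)) 0 (numeral m)
        (app predSym ![vr 0])
      have e : ∀ k, (app predSym ![vr 0]).subst (Function.update vr 0 (numeral k)) =
          app predSym ![numeral k] := by
        intro k
        rw [subst_app]
        congr 1
        ext1 i
        simp
      simp only [Formula.subst, e, (num m).subst_eq] at h1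
      have h2 := h1.imp_mp (provable_eq_symm (hp _) (num _) (provable_pred hS m))
      have h3 := (provable_eq_trans_imp (numeral m) (num m) (num n)).mp (provable_pred hS n)
      exact (h2.trans h3).mt (ih (by omega))

theorem provable_eq_realize (hS : ∀ A, BasicAxiom A → Provable S A) {t : PRTerm}
    (ht : ClosedTerm t) (e : ℕ → ℕ) : Provable S (Formula.eq t (numeral (t.realize e))) := by
  induction t with
  | var i => simp [ClosedTerm] at ht
  | @func n f ts ih =>
    have hts := closedTerm_app.1 ht
    exact provable_eq_trans ht
      (closedTerm_numeral _) (provable_eq_app f hts (fun i => closedTerm_numeral _)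
        fun i => ih i (hts i)) (provable_eval hS f fun i => (ts i).realize e)

/-- Quantifier-free sentences are decided in accordance with their truth value. -/
theorem provable_of_sat (hS : ∀ A, BasicAxiom A → Provable S A) (hA : A.QuantifierFree)
    (hc : ∀ x, ¬ A.Free x) (e : ℕ → ℕ) :
    (A.Sat e → Provable S A) ∧ (¬ A.Sat e → Provable S A.neg) := by
  have num := closedTerm_numeral
  induction A with
  | eq s t =>
    have hs : ClosedTerm s := Finset.eq_empty_of_forall_notMem fun x hx => hc x (.inl hx)
    have ht : ClosedTerm t := Finset.eq_empty_of_forall_notMem fun x hx => hc x (.inr hx)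
    have h1 := provable_eq_realize hS hs e
    have h2 := provable_eq_realize hS ht e
    constructor
    · intro h
      rw [show s.realize e = t.realize e from h] at h1
      exact provable_eq_trans hs ht h1 (provable_eq_symm ht (num _) h2)
    · intro h
      have h3 := (provable_eq_trans_imp (S := S) _ (num (s.realize e)) ht).imp_mp
        (provable_eq_symm hs (num _) h1)
      have h4 := (provable_eq_trans_imp (S := S) _ (num (s.realize e)) (num _)).mp h2
      exact (h3.trans h4).mt (provable_numeral_ne hS h)
  | neg A ih =>
    obtain ⟨h1, h2⟩ := ih hA hc
    exact ⟨h2, fun h => (h1 (not_not.1 h)).neg_neg⟩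
  | imp A B ihA ihB =>
    obtain ⟨a1, a2⟩ := ihA hA.1 fun x hx => hc x (.inl hx)
    obtain ⟨b1, b2⟩ := ihB hA.2 fun x hx => hc x (.inr hx)
    constructor
    · intro h
      by_cases ha : A.Sat e
      · exact (b1 (h ha)).imp_of_right
      · exact (a2 ha).imp_of_neg
    · intro h
      have h : A.Sat e ∧ ¬ B.Sat e := by simpa [Formula.Sat] using h
      exact (a1 h.1).neg_imp (b2 h.2)
  | all x A => exact hA.elim

/-! ## Substitution in quantifier-free formulas -/

namespace Formula

theorem QuantifierFree.subst (hA : A.QuantifierFree) (x : ℕ) (t : PRTerm) :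
    (A.subst x t).QuantifierFree := by
  induction A with
  | eq s t => trivial
  | neg A ih => exact ih hA
  | imp A B ihA ihB => exact ⟨ihA hA.1, ihB hA.2⟩
  | all y A => exact hA.elim

theorem QuantifierFree.freeFor (hA : A.QuantifierFree) (x : ℕ) (t : PRTerm) : A.FreeFor x t := by
  induction A with
  | eq s t => trivial
  | neg A ih => exact ih hA
  | imp A B ihA ihB => exact ⟨ihA hA.1, ihB hA.2⟩
  | all y A => exact hA.elim

theorem QuantifierFree.sat_subst (hA : A.QuantifierFree) (x : ℕ) (t : PRTerm) (e : ℕ → ℕ) :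
    (A.subst x t).Sat e ↔ A.Sat (Function.update e x (t.realize e)) := by
  induction A with
  | eq r s => simp only [Formula.subst, Sat, realize_subst_update]
  | neg A ih => exact not_congr (ih hA)
  | imp A B ihA ihB => exact imp_congr (ihA hA.1) (ihB hA.2)
  | all y A => exact hA.elim

theorem mem_varFinset_subst {r t : PRTerm} (ht : ClosedTerm t) {x z : ℕ} :
    z ∈ (r.subst (Function.update vr x t)).varFinset ↔ z ≠ x ∧ z ∈ r.varFinset := by
  induction r with
  | var i =>
    change z ∈ (Function.update vr x t i).varFinset ↔ z ≠ x ∧ z ∈ (vr i).varFinset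
    rw [mem_varFinset_var]
    by_cases h : i = x
    · subst h
      simp [show t.varFinset = ∅ from ht]
    · simp only [Function.update_of_ne h, mem_varFinset_var]
      constructor
      · rintro rfl; exact ⟨h, rfl⟩
      · exact fun h => h.2
  | func f ts ih =>
    change z ∈ (app f fun i => (ts i).subst _).varFinset ↔ z ≠ x ∧ z ∈ (app f ts).varFinset
    simp only [mem_varFinset_app, ih, exists_and_left]

theorem free_subst {t : PRTerm} (ht : ClosedTerm t) {x z : ℕ} :
    (A.subst x t).Free z ↔ z ≠ x ∧ A.Free z := by
  induction A with
  | eq r s => simp only [subst, Free, mem_varFinset_subst ht, ← and_or_left]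
  | neg A ih => exact ih
  | imp A B ihA ihB => simp only [subst, Free, ihA, ihB, ← and_or_left]
  | all y A ih =>
    by_cases h : x = y
    · subst h
      simp [subst, Free]
    · simp only [subst, if_neg h, Free, ih]
      tauto

theorem term_subst_self (r : PRTerm) (x : ℕ) : r.subst (Function.update vr x (vr x)) = r := by
  rw [Function.update_eq_self, term_subst_vr]

theorem subst_self (A : Formula) (x : ℕ) : A.subst x (vr x) = A := by
  induction A with
  | eq r s => simp only [subst, term_subst_self]
  | neg A ih => simp only [subst, ih]
  | imp A B ihA ihB => simp only [subst, ihA, ihB]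
  | all y A ih => simp only [subst, ih, ite_self]

theorem freeFor_self (A : Formula) (x : ℕ) : A.FreeFor x (vr x) := by
  induction A with
  | eq r s => trivial
  | neg A ih => exact ih
  | imp A B ihA ihB => exact ⟨ihA, ihB⟩
  | all y A ih =>
    by_cases h : x = y
    · exact .inl fun hf => hf.1 h
    · exact .inr ⟨fun hy => h (mem_varFinset_var.1 hy).symm, ih⟩

theorem sat_congr {e e' : ℕ → ℕ} (h : ∀ x, A.Free x → e x = e' x) : A.Sat e ↔ A.Sat e' := by
  have ht : ∀ {t : PRTerm} {e e' : ℕ → ℕ}, (∀ x ∈ t.varFinset, e x = e' x) →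
      t.realize e = t.realize e' := by
    intro t e e' h
    induction t with
    | var i => exact h i (mem_varFinset_var.2 rfl)
    | func f ts ih =>
      refine congrArg (PRSym.eval f) (funext fun i => ih i fun x hx => h x ?_)
      exact mem_varFinset_app.2 ⟨i, hx⟩
  induction A generalizing e e' with
  | eq r s => simp only [Sat, ht fun x hx => h x (.inl hx), ht fun x hx => h x (.inr hx)]
  | neg A ih => exact not_congr (ih h)
  | imp A B ihA ihB =>
    exact imp_congr (ihA fun x hx => h x (.inl hx)) (ihB fun x hx => h x (.inr hx))
  | all y A ih =>
    refine forall_congr' fun n => ih fun x hx => ?_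
    by_cases hxy : x = y
    · subst hxy; simp
    · simp [hxy, h x ⟨hxy, hx⟩]

end Formula

theorem Provable.ex_intro {x : ℕ} {t : PRTerm} (hA : A.FreeFor x t)
    (h : Provable S (A.subst x t)) : Provable S (Formula.ex x A) :=
  (Provable.logical (LogicalAxiom.inst x t A.neg hA)).neg_of_imp_neg h

/-! ## One-consistency and correctness -/

namespace IsSigmaOneMatrix

variable {x : ℕ}

theorem closed (h : IsSigmaOneMatrix x A) (n z : ℕ) : ¬ (A.subst x (numeral n)).Free z := by
  rw [Formula.free_subst (closedTerm_numeral n)]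
  exact fun hz => hz.1 (h.free z hz.2)

theorem decided (hS : ∀ A, BasicAxiom A → Provable S A) (h : IsSigmaOneMatrix x A) (n : ℕ)
    (e : ℕ → ℕ) :
    (A.Sat (Function.update e x n) → Provable S (A.subst x (numeral n))) ∧
    (¬ A.Sat (Function.update e x n) → Provable S (A.subst x (numeral n)).neg) := by
  have := provable_of_sat hS (h.quantifierFree.subst x (numeral n)) (h.closed n) e
  rwa [h.quantifierFree.sat_subst, realize_numeral] at this

theorem sat_iff (h : IsSigmaOneMatrix x A) (n : ℕ) (e e' : ℕ → ℕ) :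
    A.Sat (Function.update e x n) ↔ A.Sat (Function.update e' x n) :=
  Formula.sat_congr fun z hz => by rw [h.free z hz]; simp

theorem isTrue_iff (h : IsSigmaOneMatrix x A) (e : ℕ → ℕ) :
    (Formula.ex x A).IsTrue ↔ ∃ n, A.Sat (Function.update e x n) := by
  have : ∀ e, (Formula.ex x A).Sat e ↔ ∃ n, A.Sat (Function.update e x n) := fun e => by
    simp [Formula.ex, Formula.Sat]
  refine ⟨fun hA => (this e).1 (hA e), fun ⟨n, hn⟩ e' => (this e').2 ⟨n, ?_⟩⟩
  rwa [h.sat_iff n e' e]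

theorem provable_of_isTrue (hS : ∀ A, BasicAxiom A → Provable S A) (h : IsSigmaOneMatrix x A)
    (hA : (Formula.ex x A).IsTrue) : Provable S (Formula.ex x A) := by
  obtain ⟨n, hn⟩ := (h.isTrue_iff fun _ => 0).1 hA
  exact Provable.ex_intro (h.quantifierFree.freeFor x _) ((h.decided hS n _).1 hn)

end IsSigmaOneMatrix

theorem not_consistent_iff : ¬ Consistent S ↔ ∀ A, Provable S A := by
  refine ⟨fun h A => ?_, fun h hc => hc ⟨Formula.eq zeroT zeroT, h _, h _⟩⟩
  obtain ⟨B, h1, h2⟩ := not_not.1 h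
  exact h1.absurd h2

/-- A false `∃xA` has only false, hence refutable, instances. In the other direction correctness
yields a true instance, which is both provable and refutable; then `S` proves everything, even `∃x
¬(0 = 0)`, which correctness forbids. -/
theorem oneConsistent_iff_sigmaOneCorrect (hS : ∀ A, BasicAxiom A → Provable S A) :
    OneConsistent S ↔ SigmaOneCorrect S := by
  constructor
  · intro h x A hA hp
    by_contra hf
    rw [hA.isTrue_iff fun _ => 0, not_exists] at hf
    exact h ⟨x, A, hA, hp, fun n => (hA.decided hS n _).2 (hf n)⟩
  · rintro h ⟨x, A, hA, hp, hn⟩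
    obtain ⟨n, hsat⟩ := (hA.isTrue_iff fun _ => 0).1 (h x A hA hp)
    have hB : IsSigmaOneMatrix 0 (Formula.eq zeroT zeroT).neg :=
      ⟨trivial, fun z hz => by
        rw [Formula.Free, Formula.Free, show zeroT.varFinset = ∅ from closedTerm_zeroT] at hz
        simp at hz⟩
    have := (h 0 _ hB (((hA.decided hS n _).1 hsat).absurd (hn n))) fun _ => 0
    simp [Formula.ex, Formula.Sat] at this

theorem OneConsistent.consistent (h : OneConsistent S) : Consistent S := by
  by_contra hc
  rw [not_consistent_iff] at hc
  refine h ⟨0, Formula.eq zeroT zeroT, ⟨trivial, fun z hz => ?_⟩, hc _, fun _ => hc _⟩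
  rw [Formula.Free, show zeroT.varFinset = ∅ from closedTerm_zeroT] at hz
  simp at hz

/-- The formula to use is `¬∀yA`: unfolding the abbreviation, `∃x∀yA` is the negation of its
generalization, so nothing has to be derived. -/
theorem OmegaConsistent.twoConsistent (h : OmegaConsistent S) : TwoConsistent S := by
  rintro ⟨x, y, A, hA, hp, hn⟩
  refine h ⟨x, (Formula.all y A).neg, fun z hz => ?_, hn, hp⟩
  rcases hA.free z hz.2 with h | h
  · exact h
  · exact (hz.1 h).elim

theorem provable_all_self (x : ℕ) : Provable S ((Formula.all x A).imp A) := by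
  have := Provable.logical (S := S) (.inst x (vr x) A (A.freeFor_self x))
  rwa [A.subst_self] at this

/-- A `Σ⁰₁` matrix becomes a `Σ⁰₂` matrix through a vacuous quantifier over the fresh variable `x +
1`, and `A` and `∀yA` are then provably equivalent. -/
theorem TwoConsistent.oneConsistent (h : TwoConsistent S) : OneConsistent S := by
  rintro ⟨x, A, hA, hp, hn⟩
  have hy : ¬ A.Free (x + 1) := fun hf => by simpa using hA.free _ hf
  refine h ⟨x, x + 1, A, ⟨by simp, hA.quantifierFree, fun z hz => .inl (hA.free z hz)⟩, ?_, ?_⟩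
  · have h1 : Provable S (A.imp (Formula.all (x + 1) A)) :=
      (Provable.logical (.dist (x + 1) A A hy)).mp
        (((Provable.logical (.s A (A.imp A) A)).mp (.logical (.k _ _))).mp
          (.logical (.k _ _)) |>.gen (x + 1))
    have h2 : Provable S ((Formula.all x (Formula.all (x + 1) A).neg).imp A.neg) :=
      (provable_all_self x).trans h1.contrapose
    have h3 := Provable.logical (S := S)
      (.dist x (Formula.all x (Formula.all (x + 1) A).neg) A.neg fun hf => hf.1 rfl)
    exact (h3.mp (h2.gen x)).contrapose.mp hp
  · intro n
    have : (Formula.all (x + 1) A).subst x (numeral n) =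
        Formula.all (x + 1) (A.subst x (numeral n)) := by simp [Formula.subst]
    rw [this]
    exact (provable_all_self (x + 1)).mt (hn n)

/-! ## Gödel numbers -/

/-- The two arities are not assumed equal, because the code alone must determine the arity; hence
the equality of dependent pairs. -/
theorem PRSym.code_injective {n m : ℕ} (f : PRSym n) (g : PRSym m) (h : f.code = g.code) :
    (⟨n, f⟩ : Σ n, PRSym n) = ⟨m, g⟩ := by
  induction f generalizing m with
  | zero => cases g <;> simp [PRSym.code] at h ⊢
  | succ => cases g <;> simp [PRSym.code] at h ⊢
  | @proj n i =>
    cases g with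
    | proj j =>
      simp only [PRSym.code, Nat.pair_eq_pair] at h
      obtain ⟨-, rfl, h⟩ := h
      rw [Fin.ext h]
    | _ => simp [PRSym.code] at h
  | @comp m n f g ihf ihg =>
    cases ‹PRSym _› with
    | comp f' g' =>
      simp only [PRSym.code, Nat.pair_eq_pair, Encodable.encode_inj] at h
      obtain ⟨-, ⟨rfl, rfl⟩, hf, hg⟩ := h
      have hg := List.ofFn_injective hg
      obtain rfl := eq_of_heq (Sigma.mk.inj (ihf f' hf)).2
      obtain rfl : g = g' := funext fun i =>
        eq_of_heq (Sigma.mk.inj (ihg i (g' i) (congrFun hg i))).2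
      rfl
    | _ => simp [PRSym.code] at h
  | @prec n f g ihf ihg =>
    cases ‹PRSym _› with
    | prec f' g' =>
      simp only [PRSym.code, Nat.pair_eq_pair] at h
      obtain ⟨-, rfl, hf, hg⟩ := h
      obtain rfl := eq_of_heq (Sigma.mk.inj (ihf f' hf)).2
      obtain rfl := eq_of_heq (Sigma.mk.inj (ihg g' hg)).2
      rfl
    | _ => simp [PRSym.code] at h

theorem termCode_func {n : ℕ} (f : PRSym n) (ts : Fin n → PRTerm) :
    termCode (Term.func f ts) = Nat.pair 2 (Nat.pair n
      (Nat.pair f.code (Encodable.encode (List.ofFn fun i => termCode (ts i))))) := rfl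

theorem termCode_var (i : ℕ) : termCode (Term.var i) = Nat.pair 1 i := rfl

theorem termCode_injective : Function.Injective termCode := by
  intro s t h
  induction s generalizing t with
  | var i =>
    cases t with
    | var j => simpa [termCode_var] using h
    | func g us => rw [termCode_var, termCode_func] at h; simp at h
  | func f ts ih =>
    cases t with
    | var j => rw [termCode_var, termCode_func] at h; simp at h
    | func g us =>
      rw [termCode_func, termCode_func] at h
      simp only [Nat.pair_eq_pair, Encodable.encode_inj] at h
      obtain ⟨-, rfl, hf, hg⟩ := h
      have hg := List.ofFn_injective hg
      obtain rfl := eq_of_heq (Sigma.mk.inj (PRSym.code_injective f g hf)).2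
      exact congrArg (Term.func f) (funext fun i => ih i (congrFun hg i))

theorem Formula.code_injective : Function.Injective Formula.code := by
  intro A B h
  induction A generalizing B with
  | eq s t =>
    cases B <;> simp [Formula.code] at h ⊢
    exact ⟨termCode_injective h.1, termCode_injective h.2⟩
  | neg A ih =>
    cases B <;> simp [Formula.code] at h ⊢
    exact ih h
  | imp A C ihA ihC =>
    cases B <;> simp [Formula.code] at h ⊢
    exact ⟨ihA h.1, ihC h.2⟩
  | all x A ih =>
    cases B <;> simp [Formula.code] at h ⊢
    exact ⟨h.1, ih h.2⟩

theorem seqCode_injective : Function.Injective seqCode := fun _ _ h =>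
  Formula.code_injective.list_map (Encodable.encode_injective h)

theorem Proves.unique {p : ℕ} (h₁ : Proves S p A) (h₂ : Proves S p B) : A = B := by
  obtain ⟨L, hL, -, hA⟩ := h₁
  obtain ⟨M, hM, -, hB⟩ := h₂
  obtain rfl := seqCode_injective (hL.trans hM.symm)
  exact Option.some.inj (hA.symm.trans hB)

/-- A nonempty list is coded by the successor of a pair, which makes the inequality strict. The
recursions over arguments of terms and the descent on proofs both depend on it. -/
theorem lt_encode_of_mem {l : List ℕ} {a : ℕ} (h : a ∈ l) : a < Encodable.encode l := by
  induction l with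
  | nil => simp at h
  | cons b l ih =>
    rw [Encodable.encode_list_cons, Nat.lt_succ_iff]
    rcases List.mem_cons.1 h with rfl | h
    · exact Nat.left_le_pair _ _
    · exact (ih h).le.trans (Nat.right_le_pair _ _)

theorem termCode_lt_func {n : ℕ} (f : PRSym n) (ts : Fin n → PRTerm) (i : Fin n) :
    termCode (ts i) < termCode (app f ts) := by
  have h : termCode (ts i) < Encodable.encode (List.ofFn fun i => termCode (ts i)) :=
    lt_encode_of_mem ((List.mem_ofFn' _ _).2 ⟨i, rfl⟩)
  rw [app, termCode_func]
  exact h.trans_le ((Nat.right_le_pair _ _).trans ((Nat.right_le_pair _ _).trans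
    (Nat.right_le_pair _ _)))

theorem le_termCode_numeral (n : ℕ) : n ≤ termCode (numeral n) := by
  induction n with
  | zero => exact Nat.zero_le _
  | succ n ih => exact Nat.succ_le_of_lt (ih.trans_lt (termCode_lt_func .succ ![numeral n] 0))

theorem Proves.code_lt {p : ℕ} (h : Proves S p A) : A.code < p := by
  obtain ⟨L, rfl, -, hA⟩ := h
  exact lt_encode_of_mem (List.mem_map_of_mem (List.mem_of_getLast? hA))

/-! ## The sentence -/

section StarSentence

variable {f : PRSym 1} {g : PRSym 2}

theorem starMatrix_subst (s t r : PRTerm) (x : ℕ) :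
    (starMatrix f g s t).subst x r = starMatrix f g (s.subst (Function.update vr x r))
      (t.subst (Function.update vr x r)) := by
  have h1 : ∀ (σ : ℕ → PRTerm) (s : PRTerm), (app f ![s]).subst σ = app f ![s.subst σ] := by
    intro σ s
    rw [subst_app]; congr 1; ext1 i; simp
  have h2 : ∀ (σ : ℕ → PRTerm) (s t : PRTerm),
      (app g ![s, t]).subst σ = app g ![s.subst σ, t.subst σ] := by
    intro σ s t
    rw [subst_app]; congr 1; ext1 i
    refine Fin.cases ?_ (fun i => ?_) i <;> simp
  simp only [starMatrix, Formula.subst, h1, h2, (closedTerm_numeral 1).subst_eq]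

theorem starMatrix_quantifierFree (s t : PRTerm) : (starMatrix f g s t).QuantifierFree :=
  ⟨trivial, trivial⟩

theorem starMatrix_free {s t : PRTerm} {z : ℕ} (h : (starMatrix f g s t).Free z) :
    z ∈ s.varFinset ∨ z ∈ t.varFinset := by
  simp only [starMatrix, Formula.Free, mem_varFinset_app,
    show (numeral 1).varFinset = ∅ from closedTerm_numeral 1] at h
  simpa [Fin.exists_fin_two] using h

theorem isTwoMatrix_starMatrix : IsTwoMatrix 0 1 (starMatrix f g (vr 0) (vr 1)) :=
  ⟨by simp, starMatrix_quantifierFree _ _, fun z hz => by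
    simpa [mem_varFinset_var] using starMatrix_free hz⟩

theorem isSigmaOneMatrix_starMatrix (m : ℕ) :
    IsSigmaOneMatrix 1 (starMatrix f g (numeral m) (vr 1)) :=
  ⟨starMatrix_quantifierFree _ _, fun z hz => by
    simpa [mem_varFinset_var, show (numeral m).varFinset = ∅ from closedTerm_numeral m]
      using starMatrix_free hz⟩

theorem starMatrix_sat (s t : PRTerm) (e : ℕ → ℕ) :
    (starMatrix f g s t).Sat e ↔
      (f.eval ![s.realize e] = 1 → g.eval ![s.realize e, t.realize e] = 1) := by
  have h1 : (fun i => (![s] i).realize e) = ![s.realize e] := by ext1 i; simp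
  have h2 : (fun i => (![s, t] i).realize e) = ![s.realize e, t.realize e] := by
    ext1 i; refine Fin.cases ?_ (fun i => ?_) i <;> simp
  simp only [starMatrix, Formula.Sat, realize_app, realize_numeral, h1, h2]

theorem starInstance_isTrue (m : ℕ) :
    (starInstance f g m).IsTrue ↔ ∃ n, f.eval ![m] = 1 → g.eval ![m, n] = 1 := by
  rw [starInstance, (isSigmaOneMatrix_starMatrix m).isTrue_iff fun _ => 0]
  refine exists_congr fun n => ?_
  rw [starMatrix_sat, realize_numeral]
  simp

theorem starSentence_isTrue :
    (starSentence f g).IsTrue ↔ ∀ m, ∃ n, f.eval ![m] = 1 → g.eval ![m, n] = 1 := by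
  have : ∀ e, (starSentence f g).Sat e ↔ ∀ m, ∃ n, f.eval ![m] = 1 → g.eval ![m, n] = 1 := by
    intro e
    simp [starSentence, Formula.ex, Formula.Sat, starMatrix_sat]
  exact ⟨fun h => (this fun _ => 0).1 (h _), fun h e => (this e).2 h⟩

/-- Together with `Proves.code_lt` this makes the numeral in a proved instance smaller than the
proof, which drives the descent. -/
theorem code_starMatrix_numeral (s : PRTerm) (n : ℕ) :
    n < (starMatrix f g s (numeral n)).code := by
  refine (le_termCode_numeral n).trans_lt
    ((termCode_lt_func g ![s, numeral n] 1).trans_le ?_)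
  rw [starMatrix, Formula.code, Formula.code]
  exact (Nat.left_le_pair _ _).trans ((Nat.right_le_pair _ _).trans ((Nat.right_le_pair _ _).trans
    (Nat.right_le_pair _ _)))

namespace IsTwoMatrix

variable {x y : ℕ}

theorem subst (h : IsTwoMatrix x y A) (n : ℕ) : IsSigmaOneMatrix y (A.subst x (numeral n)) :=
  ⟨h.quantifierFree.subst _ _, fun z hz => by
    rw [Formula.free_subst (closedTerm_numeral n)] at hz
    exact (h.free z hz.2).resolve_left hz.1⟩

theorem provable_instance (h : IsTwoMatrix x y A)
    (hp : Provable S (Formula.all x (Formula.ex y A))) (n : ℕ) :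
    Provable S (Formula.ex y (A.subst x (numeral n))) := by
  have h1 : (Formula.ex y A).FreeFor x (numeral n) :=
    .inr ⟨by simp [show (numeral n).varFinset = ∅ from closedTerm_numeral n],
      h.quantifierFree.freeFor x _⟩
  have := hp.inst h1
  simpa [Formula.ex, Formula.subst, h.ne] using this

end IsTwoMatrix

/-- If `p` proves `∀x∃yA`, correctness makes the provable `∃yA(p,y)` true, and a true instance
`A(p,n)` is closed and quantifier-free, hence has a proof `q`. -/
theorem starSentence_isTrue_of_oneConsistent (hS : ∀ A, BasicAxiom A → Provable S A)
    (hf : DefinesProvesPiTwo S f) (hg : DefinesProvesInstance S g) (h : OneConsistent S) :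
    (starSentence f g).IsTrue := by
  rw [starSentence_isTrue]
  intro p
  by_cases hp : ProvesPiTwo S p
  · obtain ⟨x, y, A, hA, hp⟩ := hp
    obtain ⟨n, hn⟩ := ((hA.subst p).isTrue_iff fun _ => 0).1
      ((oneConsistent_iff_sigmaOneCorrect hS).1 h _ _ (hA.subst p)
        (hA.provable_instance ⟨p, hp⟩ p))
    obtain ⟨q, hq⟩ := ((hA.subst p).decided hS n _).1 hn
    exact ⟨q, fun _ => (hg p q).2 ⟨x, y, A, hA, hp, n, hq⟩⟩
  -- Here `f(p) ≠ 1`, so the conditional is vacuous and any `y` will do.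
  · exact ⟨0, fun h => (hp ((hf p).1 h)).elim⟩

theorem starSentence_isTrue_of_not_consistent (hf : DefinesProvesPiTwo S f)
    (hg : DefinesProvesInstance S g) (h : ¬ Consistent S) : (starSentence f g).IsTrue := by
  rw [starSentence_isTrue]
  intro p
  by_cases hp : ProvesPiTwo S p
  · obtain ⟨x, y, A, hA, hp⟩ := hp
    obtain ⟨q, hq⟩ := not_consistent_iff.1 h ((A.subst x (numeral p)).subst y (numeral 0))
    exact ⟨q, fun _ => (hg p q).2 ⟨x, y, A, hA, hp, 0, hq⟩⟩
  · exact ⟨0, fun h => (hp ((hf p).1 h)).elim⟩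

/-- If `p` proved the sentence, every proof of an instance at `p` would yield a smaller one. -/
theorem not_provable_starSentence (hS : ∀ A, BasicAxiom A → Provable S A)
    (hf : DefinesProvesPiTwo S f) (hg : DefinesProvesInstance S g) (h : OneConsistent S) :
    ¬ Provable S (starSentence f g) := by
  rintro ⟨p, hp⟩
  have hfp : f.eval ![p] = 1 := (hf p).2 ⟨0, 1, _, isTwoMatrix_starMatrix, hp⟩
  have descent : ∀ q, g.eval ![p, q] ≠ 1 := by
    intro q
    induction q using Nat.strong_induction_on with
    | _ q ih =>
      intro hq
      obtain ⟨x, y, A, -, hpA, n, hqA⟩ := (hg p q).1 hq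
      -- A proof has only one last line, so the `Π⁰₂` sentence proved by `p` is `(***)` itself, with
      -- its own variables and matrix.
      have e := hpA.unique hp
      simp only [starSentence, Formula.ex, Formula.all.injEq, Formula.neg.injEq] at e
      obtain ⟨rfl, rfl, rfl⟩ := e
      have e2 : ((starMatrix f g (vr 0) (vr 1)).subst 0 (numeral p)).subst 1 (numeral n) =
          starMatrix f g (numeral p) (numeral n) := by
        simp [starMatrix_subst, (closedTerm_numeral p).subst_eq]
      rw [e2] at hqA
      refine ih n ((code_starMatrix_numeral _ n).trans hqA.code_lt) ?_
      -- With `f(p) = 1` and `g(p,n) ≠ 1` the closed conditional is false, so `S` refutes what `q`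
      -- proves.
      by_contra hn
      have hfalse := (provable_of_sat hS (starMatrix_quantifierFree (f := f) (g := g) (numeral p)
        (numeral n)) (fun z hz => by
          simpa [show ∀ n, (numeral n).varFinset = ∅ from closedTerm_numeral]
            using starMatrix_free hz) fun _ => 0).2 (by
          rw [starMatrix_sat, realize_numeral, realize_numeral]
          exact fun h => hn (h hfp))
      exact h.consistent ⟨_, ⟨q, hqA⟩, hfalse⟩
  obtain ⟨q, hq⟩ := starSentence_isTrue.1 (starSentence_isTrue_of_oneConsistent hS hf hg h) p
  exact descent q (hq hfp)

theorem provable_starInstance (hS : ∀ A, BasicAxiom A → Provable S A)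
    (h : (starSentence f g).IsTrue) (m : ℕ) : Provable S (starInstance f g m) :=
  (isSigmaOneMatrix_starMatrix m).provable_of_isTrue hS
    ((starInstance_isTrue m).2 (starSentence_isTrue.1 h m))

theorem not_provable_neg_starSentence (hS : ∀ A, BasicAxiom A → Provable S A)
    (hf : DefinesProvesPiTwo S f) (hg : DefinesProvesInstance S g) (h : TwoConsistent S) :
    ¬ Provable S (starSentence f g).neg := by
  intro hn
  refine h ⟨0, 1, (starMatrix f g (vr 0) (vr 1)).neg,
    ⟨by simp, starMatrix_quantifierFree _ _, isTwoMatrix_starMatrix.free⟩, ?_, fun n => ?_⟩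
  -- Unfolding `∃` on both sides, `∃x∀y¬M` and `¬∀x∃yM` are the same formula.
  · exact hn
  · have := provable_starInstance hS
      (starSentence_isTrue_of_oneConsistent hS hf hg h.oneConsistent) n
    simpa [Formula.subst, starMatrix_subst, subst_var, starInstance, Formula.ex] using this

end StarSentence

/-! ### Course-of-values recursion -/

section CourseOfValues

variable {α σ : Type*}

/-- Course-of-values recursion: the step function receives the list of the earlier values. -/
def courseRec (step : α → ℕ → List σ → σ) (a : α) (n : ℕ) : σ :=
  step a n (List.ofFn fun i : Fin n => courseRec step a i)

theorem courseRec_eq (step : α → ℕ → List σ → σ) (a : α) (n : ℕ) :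
    courseRec step a n = step a n ((List.range n).map (courseRec step a)) := by
  rw [courseRec]
  congr 1
  apply List.ext_getElem <;> simp

theorem getD_map_range (f : ℕ → σ) {i n : ℕ} (h : i < n) (d : σ) :
    ((List.range n).map f).getD i d = f i := by
  simp [h]

end CourseOfValues

/-! ## Primitive recursive functions in Mathlib's sense -/

section Primrec

variable {α β γ σ : Type*} [Primcodable α] [Primcodable β] [Primcodable γ] [Primcodable σ]

attribute [fun_prop] Primrec.id Primrec.const Primrec.comp

@[fun_prop]
theorem primrec_mk {f : α → β} {g : α → γ} (hf : Primrec f) (hg : Primrec g) :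
    Primrec fun a => (f a, g a) := hf.pair hg

@[fun_prop]
theorem primrec_fst {f : α → β × γ} (hf : Primrec f) : Primrec fun a => (f a).1 :=
  Primrec.fst.comp hf

@[fun_prop]
theorem primrec_snd {f : α → β × γ} (hf : Primrec f) : Primrec fun a => (f a).2 :=
  Primrec.snd.comp hf

@[fun_prop]
theorem primrec_add {f g : α → ℕ} (hf : Primrec f) (hg : Primrec g) :
    Primrec fun a => f a + g a := Primrec.nat_add.comp hf hg

@[fun_prop]
theorem primrec_sub {f g : α → ℕ} (hf : Primrec f) (hg : Primrec g) :
    Primrec fun a => f a - g a := Primrec.nat_sub.comp hf hg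

@[fun_prop]
theorem primrec_natPair {f g : α → ℕ} (hf : Primrec f) (hg : Primrec g) :
    Primrec fun a => Nat.pair (f a) (g a) := Primrec₂.natPair.comp hf hg

@[fun_prop]
theorem primrec_unpair {f : α → ℕ} (hf : Primrec f) : Primrec fun a => (f a).unpair :=
  Primrec.unpair.comp hf

@[fun_prop]
theorem primrec_cond {c : α → Bool} {f g : α → σ} (hc : Primrec c) (hf : Primrec f)
    (hg : Primrec g) : Primrec fun a => bif c a then f a else g a := Primrec.cond hc hf hg

@[fun_prop]
theorem primrec_not {f : α → Bool} (hf : Primrec f) : Primrec fun a => !f a :=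
  Primrec.not.comp hf

@[fun_prop]
theorem primrec_and {f g : α → Bool} (hf : Primrec f) (hg : Primrec g) :
    Primrec fun a => f a && g a := Primrec.and.comp hf hg

@[fun_prop]
theorem primrec_or {f g : α → Bool} (hf : Primrec f) (hg : Primrec g) :
    Primrec fun a => f a || g a := Primrec.or.comp hf hg

@[fun_prop]
theorem primrec_beq [DecidableEq β] {f g : α → β} (hf : Primrec f) (hg : Primrec g) :
    Primrec fun a => f a == g a := Primrec.beq.comp hf hg

@[fun_prop]
theorem primrec_lt {f g : α → ℕ} (hf : Primrec f) (hg : Primrec g) :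
    Primrec fun a => decide (f a < g a) := Primrec.nat_lt.decide.comp hf hg

@[fun_prop]
theorem primrec_range {f : α → ℕ} (hf : Primrec f) : Primrec fun a => List.range (f a) :=
  Primrec.list_range.comp hf

@[fun_prop]
theorem primrec_length {f : α → List β} (hf : Primrec f) : Primrec fun a => (f a).length :=
  Primrec.list_length.comp hf

@[fun_prop]
theorem primrec_getD {f : α → List β} {g : α → ℕ} (d : β) (hf : Primrec f) (hg : Primrec g) :
    Primrec fun a => (f a).getD (g a) d := (Primrec.list_getD d).comp hf hg

@[fun_prop]
theorem primrec_map {f : α → List β} {g : α → β → γ} (hf : Primrec f)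
    (hg : Primrec fun p : α × β => g p.1 p.2) : Primrec fun a => (f a).map (g a) :=
  Primrec.list_map hf hg

@[fun_prop]
theorem primrec_any {f : α → List β} {g : α → β → Bool} (hf : Primrec f)
    (hg : Primrec fun p : α × β => g p.1 p.2) : Primrec fun a => (f a).any (g a) := by
  refine (Primrec.list_foldr (h := fun a p => g a p.1 || p.2) hf (Primrec.const false) ?_).of_eq
    fun a => ?_
  · exact Primrec.or.comp
      (hg.comp (g := fun x : α × β × Bool => (x.1, x.2.1)) (by fun_prop)) (by fun_prop)
  · induction f a with
    | nil => rfl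
    | cons b l ih => simp [ih]

@[fun_prop]
theorem primrec_all {f : α → List β} {g : α → β → Bool} (hf : Primrec f)
    (hg : Primrec fun p : α × β => g p.1 p.2) : Primrec fun a => (f a).all (g a) := by
  refine (Primrec.list_foldr (h := fun a p => g a p.1 && p.2) hf (Primrec.const true) ?_).of_eq
    fun a => ?_
  · exact Primrec.and.comp
      (hg.comp (g := fun x : α × β × Bool => (x.1, x.2.1)) (by fun_prop)) (by fun_prop)
  · induction f a with
    | nil => rfl
    | cons b l ih => simp [ih]

@[fun_prop]
theorem primrec_encode {f : α → List ℕ} (hf : Primrec f) :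
    Primrec fun a => Encodable.encode (f a) := Primrec.encode.comp hf

/-- The list of natural numbers with a given code. -/
def decodeList (n : ℕ) : List ℕ := Denumerable.ofNat (List ℕ) n

@[fun_prop]
theorem primrec_decodeList {f : α → ℕ} (hf : Primrec f) : Primrec fun a => decodeList (f a) :=
  (Primrec.ofNat (List ℕ)).comp hf

theorem decodeList_encode (l : List ℕ) : decodeList (Encodable.encode l) = l :=
  Denumerable.ofNat_encode l

theorem encode_decodeList (n : ℕ) : Encodable.encode (decodeList n) = n :=
  Denumerable.encode_ofNat n

theorem primrec_courseRec {step : α → ℕ → List σ → σ}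
    (h : Primrec fun p : α × ℕ × List σ => step p.1 p.2.1 p.2.2) {f : β → α} {g : β → ℕ}
    (hf : Primrec f) (hg : Primrec g) : Primrec fun b => courseRec step (f b) (g b) := by
  have : Primrec₂ (courseRec step) := by
    -- The argument `n` is recovered as the number of earlier values.
    refine Primrec.nat_strong_rec _ (g := fun a l => some (step a l.length l)) ?_ fun a n => ?_
    · refine Primrec.option_some.comp (h.comp (g := fun p : α × List σ => (p.1, p.2.length, p.2)) ?_)
      fun_prop
    · rw [courseRec_eq]
      simp
  exact this.comp hf hg

end Primrec

/-! ### Function symbols for primitive recursive functions -/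

section Symbols

/-- Every primitive recursive function is the value of a symbol. -/
theorem exists_eval_eq {n : ℕ} {F : List.Vector ℕ n → ℕ} (h : Nat.Primrec' F) :
    ∃ f : PRSym n, ∀ v : Fin n → ℕ, f.eval v = F (List.Vector.ofFn v) := by
  induction h with
  | zero => exact ⟨.zero, fun v => rfl⟩
  | succ => exact ⟨.succ, fun v => by simp [PRSym.eval, List.Vector.ofFn]⟩
  | get i => exact ⟨.proj i, fun v => by simp [PRSym.eval]⟩
  | comp g _ _ ihf ihg =>
    obtain ⟨f, hf⟩ := ihf
    choose g hg using ihg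
    exact ⟨.comp f g, fun v => by simp [PRSym.eval, hf, hg]⟩
  | prec _ _ ihf ihg =>
    obtain ⟨f, hf⟩ := ihf
    obtain ⟨g, hg⟩ := ihg
    refine ⟨.prec f g, fun v => ?_⟩
    simp only [PRSym.eval, hf, hg]
    have h1 : (List.Vector.ofFn v).head = v 0 := rfl
    have h2 : (List.Vector.ofFn v).tail = List.Vector.ofFn (Fin.tail v) := rfl
    rw [h1, h2]
    rfl

theorem exists_eval_one {F : ℕ → Bool} (h : Primrec F) :
    ∃ f : PRSym 1, ∀ p, f.eval ![p] = 1 ↔ F p = true := by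
  have h1 : Primrec fun p => bif F p then 1 else 0 := by fun_prop
  obtain ⟨f, hf⟩ := exists_eval_eq (Nat.Primrec'.prim_iff₁.2 h1)
  refine ⟨f, fun p => ?_⟩
  rw [hf]
  have : (List.Vector.ofFn ![p]).head = p := rfl
  rw [this]
  cases F p <;> simp

theorem exists_eval_two {F : ℕ → ℕ → Bool} (h : Primrec fun p : ℕ × ℕ => F p.1 p.2) :
    ∃ f : PRSym 2, ∀ p q, f.eval ![p, q] = 1 ↔ F p q = true := by
  have h1 : Primrec₂ fun p q => bif F p q then 1 else 0 :=
    (primrec_cond h (Primrec.const 1) (Primrec.const 0))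
  obtain ⟨f, hf⟩ := exists_eval_eq (Nat.Primrec'.prim_iff₂.2 h1)
  refine ⟨f, fun p q => ?_⟩
  rw [hf]
  have e1 : (List.Vector.ofFn ![p, q]).head = p := rfl
  have e2 : (List.Vector.ofFn ![p, q]).tail.head = q := rfl
  rw [e1, e2]
  cases F p q <;> simp

end Symbols

/-! ## Syntactic operations on Gödel numbers -/

section Codes

/-- The list of the codes of the arguments of a function term. -/
def argCodes (c : ℕ) : List ℕ := decodeList c.unpair.2.unpair.2.unpair.2

@[fun_prop]
theorem primrec_argCodes {α : Type*} [Primcodable α] {f : α → ℕ} (hf : Primrec f) :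
    Primrec fun a => argCodes (f a) := by
  unfold argCodes
  fun_prop

theorem lt_pair {a : ℕ} (b : ℕ) (h : 0 < a) : b < Nat.pair a b :=
  (Nat.lt_add_of_pos_left h).trans_le (Nat.add_le_pair a b)

theorem lt_pair_of_le {a b c : ℕ} (h : 0 < a) (hc : c ≤ b) : c < Nat.pair a b :=
  hc.trans_lt (lt_pair b h)

theorem lt_of_unpair {a c : ℕ} (h : c.unpair.1 = a + 1) : c.unpair.2 < c := by
  have := lt_pair (a := a + 1) c.unpair.2 (by omega)
  rwa [← h, Nat.pair_unpair] at this

/-- The positive tag matters: it guarantees that the arguments are found in the list of earlier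
values, even when `c` codes no term. -/
theorem mem_argCodes_lt {a b c : ℕ} (h : c.unpair.1 = a + 1) (hb : b ∈ argCodes c) : b < c := by
  have := lt_encode_of_mem hb
  rw [argCodes, encode_decodeList] at this
  exact this.trans_le ((Nat.unpair_right_le _).trans ((Nat.unpair_right_le _).trans
    (lt_of_unpair h).le))

theorem argCodes_termCode {n : ℕ} (f : PRSym n) (ts : Fin n → PRTerm) :
    argCodes (termCode (Term.func f ts)) = List.ofFn fun i => termCode (ts i) := by
  simp [argCodes, termCode_func, decodeList_encode]

/-- The arity plus one of the symbol with code `c`; zero if there is no such symbol. -/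
def symArity : ℕ → ℕ :=
  courseRec (fun (_ : ℕ) c (l : List ℕ) =>
    bif c.unpair.1 == 1 then (bif c.unpair.2 == 0 then 1 else 0)
    else bif c.unpair.1 == 2 then (bif c.unpair.2 == 0 then 2 else 0)
    else bif c.unpair.1 == 3 then
      (bif decide (c.unpair.2.unpair.2 < c.unpair.2.unpair.1) then c.unpair.2.unpair.1 + 1 else 0)
    else bif c.unpair.1 == 4 then
      (bif l.getD c.unpair.2.unpair.2.unpair.1 0 == c.unpair.2.unpair.1.unpair.2 + 1 &&
        ((argCodes c).length == c.unpair.2.unpair.1.unpair.2 &&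
        (argCodes c).all fun b => l.getD b 0 == c.unpair.2.unpair.1.unpair.1 + 1)
      then c.unpair.2.unpair.1.unpair.1 + 1 else 0)
    else bif c.unpair.1 == 5 then
      (bif l.getD c.unpair.2.unpair.2.unpair.1 0 == c.unpair.2.unpair.1 + 1 &&
        l.getD c.unpair.2.unpair.2.unpair.2 0 == c.unpair.2.unpair.1 + 3
      then c.unpair.2.unpair.1 + 2 else 0)
    else 0) 0

@[fun_prop]
theorem primrec_symArity {α : Type*} [Primcodable α] {f : α → ℕ} (hf : Primrec f) :
    Primrec fun a => symArity (f a) :=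
  primrec_courseRec (by fun_prop) (by fun_prop) hf

/-- All codes consulted lie below `c`, so lookups turn into recursive calls. The inner symbols of a
composition are stored where a function term stores its arguments, which is why `argCodes` serves
for both. -/
theorem symArity_comp {c m n : ℕ} (h : c.unpair.1 = 4)
    (hmn : c.unpair.2.unpair.1 = Nat.pair m n) :
    symArity c = if symArity c.unpair.2.unpair.2.unpair.1 = n + 1 ∧ (argCodes c).length = n ∧
      ∀ b ∈ argCodes c, symArity b = m + 1 then m + 1 else 0 := by
  have h1 : c.unpair.2.unpair.2.unpair.1 < c := (Nat.unpair_left_le _).trans_lt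
    ((Nat.unpair_right_le _).trans_lt (lt_of_unpair h))
  have h2 : ∀ (F : ℕ → ℕ) (k : ℕ),
      ((argCodes c).all fun b => ((List.range c).map F).getD b 0 == k) =
        (argCodes c).all fun b => F b == k := by
    intro F k
    rw [Bool.eq_iff_iff, List.all_eq_true, List.all_eq_true]
    refine forall₂_congr fun b hb => ?_
    rw [getD_map_range _ (mem_argCodes_lt h hb)]
  rw [symArity, courseRec_eq]
  simp only [h, hmn, Nat.unpair_pair, getD_map_range _ h1, h2]
  simp [Bool.cond_eq_ite]

theorem symArity_prec {c : ℕ} (h : c.unpair.1 = 5) :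
    symArity c = if symArity c.unpair.2.unpair.2.unpair.1 = c.unpair.2.unpair.1 + 1 ∧
      symArity c.unpair.2.unpair.2.unpair.2 = c.unpair.2.unpair.1 + 3
      then c.unpair.2.unpair.1 + 2 else 0 := by
  have h1 : c.unpair.2.unpair.2.unpair.1 < c := (Nat.unpair_left_le _).trans_lt
    ((Nat.unpair_right_le _).trans_lt (lt_of_unpair h))
  have h2 : c.unpair.2.unpair.2.unpair.2 < c := (Nat.unpair_right_le _).trans_lt
    ((Nat.unpair_right_le _).trans_lt (lt_of_unpair h))
  rw [symArity, courseRec_eq]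
  simp only [h, getD_map_range _ h1, getD_map_range _ h2]
  simp [Bool.cond_eq_ite]

theorem symArity_code {n : ℕ} (f : PRSym n) : symArity f.code = n + 1 := by
  induction f with
  | zero => rw [symArity, courseRec_eq]; simp [PRSym.code]
  | succ => rw [symArity, courseRec_eq]; simp [PRSym.code]
  | proj i => rw [symArity, courseRec_eq]; simp [PRSym.code]
  | @comp m n f g ihf ihg =>
    rw [symArity_comp (m := m) (n := n) (by simp [PRSym.code]) (by simp [PRSym.code])]
    simp [PRSym.code, argCodes, decodeList_encode, ihf, ihg]
  | @prec n f g ihf ihg =>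
    rw [symArity_prec (by simp [PRSym.code])]
    simp [PRSym.code, ihf, ihg]

/-- The symbol is rebuilt by strong induction on the code, by cases on the tag; tags other than `1`
to `5` give the value `0`, which is not of the form `n + 1`. -/
theorem exists_code_of_symArity {c n : ℕ} (h : symArity c = n + 1) :
    ∃ f : PRSym n, f.code = c := by
  induction c using Nat.strong_induction_on generalizing n with
  | _ c ih =>
    obtain ⟨t, r, rfl⟩ : ∃ t r, c = Nat.pair t r := ⟨_, _, (Nat.pair_unpair c).symm⟩
    rcases t with _ | _ | _ | _ | _ | _ | t
    · rw [symArity, courseRec_eq] at h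
      simp at h
    · rw [symArity, courseRec_eq] at h
      by_cases hr : r = 0
      · subst hr
        obtain rfl : n = 0 := by simpa using h.symm
        exact ⟨.zero, rfl⟩
      · simp [Bool.cond_eq_ite, hr] at h
    · rw [symArity, courseRec_eq] at h
      by_cases hr : r = 0
      · subst hr
        obtain rfl : n = 1 := by simpa using h.symm
        exact ⟨.succ, rfl⟩
      · simp [Bool.cond_eq_ite, hr] at h
    · rw [symArity, courseRec_eq] at h
      obtain ⟨m, i, rfl⟩ : ∃ m i, r = Nat.pair m i := ⟨_, _, (Nat.pair_unpair r).symm⟩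
      by_cases hi : i < m
      · obtain rfl : n = m := by simpa [hi] using h.symm
        exact ⟨.proj ⟨i, hi⟩, rfl⟩
      · simp [hi] at h
    · obtain ⟨mn, fg, rfl⟩ : ∃ m i, r = Nat.pair m i := ⟨_, _, (Nat.pair_unpair r).symm⟩
      obtain ⟨m, k, rfl⟩ : ∃ m i, mn = Nat.pair m i := ⟨_, _, (Nat.pair_unpair mn).symm⟩
      obtain ⟨fc, gc, rfl⟩ : ∃ m i, fg = Nat.pair m i := ⟨_, _, (Nat.pair_unpair fg).symm⟩
      obtain ⟨l, rfl⟩ : ∃ l : List ℕ, gc = Encodable.encode l := ⟨_, (encode_decodeList gc).symm⟩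
      rw [symArity_comp (m := m) (n := k) (by simp) (by simp)] at h
      split_ifs at h with hc
      obtain rfl : m = n := by simpa using h
      have hl : argCodes (Nat.pair (0 + 1 + 1 + 1 + 1) (Nat.pair (Nat.pair m k)
          (Nat.pair fc (Encodable.encode l)))) = l := by simp [argCodes, decodeList_encode]
      have hlt := fun b => mem_argCodes_lt (b := b) (c := Nat.pair (0 + 1 + 1 + 1 + 1)
        (Nat.pair (Nat.pair m k) (Nat.pair fc (Encodable.encode l)))) (a := 3) (by simp)
      rw [hl] at hc hlt
      obtain ⟨hf, rfl, hg⟩ := hc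
      obtain ⟨f, hf⟩ := ih fc (lt_pair_of_le (by omega) ((Nat.left_le_pair _ _).trans
        (Nat.right_le_pair _ _))) (by simpa using hf)
      have : ∀ i : Fin l.length, ∃ g : PRSym m, g.code = l[i] := fun i =>
        ih _ (hlt _ (List.getElem_mem _)) (hg _ (List.getElem_mem _))
      choose g hg using this
      refine ⟨.comp f g, ?_⟩
      simp only [PRSym.code, hf, hg, Fin.getElem_fin, List.ofFn_getElem]
    · obtain ⟨k, fg, rfl⟩ : ∃ m i, r = Nat.pair m i := ⟨_, _, (Nat.pair_unpair r).symm⟩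
      obtain ⟨fc, gc, rfl⟩ : ∃ m i, fg = Nat.pair m i := ⟨_, _, (Nat.pair_unpair fg).symm⟩
      rw [symArity_prec (by simp)] at h
      split_ifs at h with hc
      obtain rfl : k + 1 = n := by simpa using h
      simp only [Nat.unpair_pair] at hc
      obtain ⟨f, rfl⟩ := ih fc (lt_pair_of_le (by omega) ((Nat.left_le_pair _ _).trans
        (Nat.right_le_pair _ _))) hc.1
      obtain ⟨g, rfl⟩ := ih gc (lt_pair_of_le (by omega) ((Nat.right_le_pair _ _).trans
        (Nat.right_le_pair _ _))) (n := k + 2) hc.2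
      exact ⟨.prec f g, rfl⟩
    · rw [symArity, courseRec_eq] at h
      simp at h

/-- The number is the code of a term. -/
def isTermCode : ℕ → Bool :=
  courseRec (fun (_ : ℕ) c (l : List Bool) =>
    c.unpair.1 == 1 || (c.unpair.1 == 2 &&
      (symArity c.unpair.2.unpair.2.unpair.1 == c.unpair.2.unpair.1 + 1 &&
        ((argCodes c).length == c.unpair.2.unpair.1 &&
          (argCodes c).all fun b => l.getD b false)))) 0

@[fun_prop]
theorem primrec_isTermCode {α : Type*} [Primcodable α] {f : α → ℕ} (hf : Primrec f) :
    Primrec fun a => isTermCode (f a) :=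
  primrec_courseRec (by fun_prop) (by fun_prop) hf

theorem isTermCode_eq (c : ℕ) : isTermCode c = true ↔ c.unpair.1 = 1 ∨ (c.unpair.1 = 2 ∧
    symArity c.unpair.2.unpair.2.unpair.1 = c.unpair.2.unpair.1 + 1 ∧
      (argCodes c).length = c.unpair.2.unpair.1 ∧ ∀ b ∈ argCodes c, isTermCode b = true) := by
  rw [isTermCode, courseRec_eq]
  simp only [Bool.or_eq_true, Bool.and_eq_true, beq_iff_eq, List.all_eq_true]
  refine or_congr_right (and_congr_right fun h => and_congr_right fun _ => and_congr_right fun _ =>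
    forall₂_congr fun b hb => ?_)
  rw [getD_map_range _ (mem_argCodes_lt h hb)]

theorem isTermCode_iff {c : ℕ} : isTermCode c = true ↔ ∃ t, termCode t = c := by
  constructor
  · intro h
    induction c using Nat.strong_induction_on with
    | _ c ih =>
      rcases (isTermCode_eq c).1 h with h | ⟨h, hf, hl, ht⟩
      · exact ⟨vr c.unpair.2, by rw [termCode_var, ← h, Nat.pair_unpair]⟩
      · obtain ⟨f, hf⟩ := exists_code_of_symArity hf
        have : ∀ i : Fin c.unpair.2.unpair.1, ∃ t, termCode t = (argCodes c)[i]'(by omega) :=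
          fun i => ih _ (mem_argCodes_lt h (List.getElem_mem _)) (ht _ (List.getElem_mem _))
        choose ts hts using this
        refine ⟨app f ts, ?_⟩
        have hof : (List.ofFn fun i => termCode (ts i)) = argCodes c := by
          apply List.ext_getElem
          · simp [hl]
          · intro i h1 h2
            simp [hts]
        rw [app, termCode_func, hof, hf, argCodes, encode_decodeList, Nat.pair_unpair,
          Nat.pair_unpair, ← h, Nat.pair_unpair]
  · rintro ⟨t, rfl⟩
    induction t with
    | var i => rw [isTermCode_eq]; simp [termCode_var]
    | @func n f ts ih =>
      rw [isTermCode_eq, argCodes_termCode]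
      refine .inr ⟨by simp [termCode_func], ?_, by simp [termCode_func], ?_⟩
      · simp [termCode_func, symArity_code f]
      · intro b hb
        obtain ⟨i, rfl⟩ := (List.mem_ofFn' _ _).1 hb
        exact ih i

/-- The variable `x` occurs in the term with code `c`. -/
def occursCode : ℕ → ℕ → Bool :=
  courseRec fun x c (l : List Bool) =>
    bif c.unpair.1 == 1 then c.unpair.2 == x else (argCodes c).any fun b => l.getD b false

@[fun_prop]
theorem primrec_occursCode {α : Type*} [Primcodable α] {f g : α → ℕ} (hf : Primrec f)
    (hg : Primrec g) : Primrec fun a => occursCode (f a) (g a) :=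
  primrec_courseRec (by fun_prop) hf hg

theorem lt_termCode_of_mem {n : ℕ} {f : PRSym n} {ts : Fin n → PRTerm} {b : ℕ}
    (h : b ∈ List.ofFn fun i => termCode (ts i)) : b < termCode (Term.func f ts) := by
  obtain ⟨i, rfl⟩ := (List.mem_ofFn' _ _).1 h
  exact termCode_lt_func f ts i

theorem occursCode_iff {x : ℕ} {t : PRTerm} :
    occursCode x (termCode t) = true ↔ x ∈ t.varFinset := by
  induction t with
  | var i =>
    rw [occursCode, courseRec_eq, mem_varFinset_var]
    simp only [termCode_var, Nat.unpair_pair, beq_self_eq_true, cond_true, beq_iff_eq]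
    exact eq_comm
  | @func n f ts ih =>
    rw [occursCode, courseRec_eq, argCodes_termCode]
    have h : (termCode (Term.func f ts)).unpair.1 = 2 := by simp [termCode_func]
    simp only [h]
    change List.any _ _ = true ↔ x ∈ (app f ts).varFinset
    rw [List.any_eq_true, mem_varFinset_app]
    constructor
    · rintro ⟨b, hb, h⟩
      rw [getD_map_range _ (lt_termCode_of_mem hb)] at h
      obtain ⟨i, rfl⟩ := (List.mem_ofFn' _ _).1 hb
      exact ⟨i, (ih i).1 h⟩
    · rintro ⟨i, hi⟩
      have hb : termCode (ts i) ∈ List.ofFn fun i => termCode (ts i) :=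
        (List.mem_ofFn' _ _).2 ⟨i, rfl⟩
      refine ⟨_, hb, ?_⟩
      rw [getD_map_range _ (lt_termCode_of_mem hb)]
      exact (ih i).2 hi

/-- Substitution of the term with code `a.2` for the variable `a.1` in a term. -/
def substTermCode : ℕ × ℕ → ℕ → ℕ :=
  courseRec fun a c (l : List ℕ) =>
    bif c.unpair.1 == 1 then (bif c.unpair.2 == a.1 then a.2 else c)
    else Nat.pair 2 (Nat.pair c.unpair.2.unpair.1 (Nat.pair c.unpair.2.unpair.2.unpair.1
      (Encodable.encode ((argCodes c).map fun b => l.getD b 0))))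

@[fun_prop]
theorem primrec_substTermCode {α : Type*} [Primcodable α] {f : α → ℕ × ℕ} {g : α → ℕ}
    (hf : Primrec f) (hg : Primrec g) : Primrec fun a => substTermCode (f a) (g a) :=
  primrec_courseRec (by fun_prop) hf hg

theorem substTermCode_eq (x : ℕ) (t r : PRTerm) : substTermCode (x, termCode t) (termCode r) =
    termCode (r.subst (Function.update vr x t)) := by
  induction r with
  | var i =>
    rw [substTermCode, courseRec_eq]
    change _ = termCode (Function.update vr x t i)
    by_cases h : i = x
    · subst h
      simp [termCode_var]
    · simp [termCode_var, h, Bool.cond_eq_ite]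
  | @func n f ts ih =>
    rw [substTermCode, courseRec_eq, argCodes_termCode]
    change _ = termCode (Term.func f fun i => (ts i).subst _)
    have h : (termCode (Term.func f ts)).unpair.1 = 2 := by simp [termCode_func]
    simp only [h]
    have hm : ((List.ofFn fun i => termCode (ts i)).map fun b =>
        ((List.range (termCode (Term.func f ts))).map (substTermCode (x, termCode t))).getD b 0) =
        List.ofFn fun i => termCode ((ts i).subst (Function.update vr x t)) := by
      rw [List.map_ofFn]
      congr 1
      ext1 i
      rw [Function.comp_apply, getD_map_range _ (show _ < termCode (Term.func f ts) from termCode_lt_func f ts i), ih]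
    rw [substTermCode] at hm
    rw [hm]
    simp [termCode_func]

end Codes

/-! ### Recognition, free variables and substitution for codes of formulas -/

section FormulaCodes

variable {α : Type*} [Primcodable α]

/-- The number is the code of a formula. -/
def isFormulaCode : ℕ → Bool :=
  courseRec (fun (_ : ℕ) c (l : List Bool) =>
    (c.unpair.1 == 1 && (isTermCode c.unpair.2.unpair.1 && isTermCode c.unpair.2.unpair.2)) ||
    ((c.unpair.1 == 2 && l.getD c.unpair.2 false) ||
    ((c.unpair.1 == 3 && (l.getD c.unpair.2.unpair.1 false && l.getD c.unpair.2.unpair.2 false)) ||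
    (c.unpair.1 == 4 && l.getD c.unpair.2.unpair.2 false)))) 0

@[fun_prop]
theorem primrec_isFormulaCode {f : α → ℕ} (hf : Primrec f) :
    Primrec fun a => isFormulaCode (f a) :=
  primrec_courseRec (by fun_prop) (by fun_prop) hf

theorem left_lt_pair_pair {k : ℕ} (a b : ℕ) (h : 0 < k) : a < Nat.pair k (Nat.pair a b) :=
  lt_pair_of_le h (Nat.left_le_pair _ _)

theorem right_lt_pair_pair {k : ℕ} (a b : ℕ) (h : 0 < k) : b < Nat.pair k (Nat.pair a b) :=
  lt_pair_of_le h (Nat.right_le_pair _ _)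

/-- The lookup of earlier values in a course-of-values recursion on codes of formulas. -/
theorem getD_arg {σ : Type*} (f : ℕ → σ) {k : ℕ} (a : ℕ) (h : 0 < k) (d : σ) :
    ((List.range (Nat.pair k a)).map f).getD a d = f a :=
  getD_map_range f (lt_pair a h) d

theorem getD_left {σ : Type*} (f : ℕ → σ) {k : ℕ} (a b : ℕ) (h : 0 < k) (d : σ) :
    ((List.range (Nat.pair k (Nat.pair a b))).map f).getD a d = f a :=
  getD_map_range f (left_lt_pair_pair a b h) d

theorem getD_right {σ : Type*} (f : ℕ → σ) {k : ℕ} (a b : ℕ) (h : 0 < k) (d : σ) :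
    ((List.range (Nat.pair k (Nat.pair a b))).map f).getD b d = f b :=
  getD_map_range f (right_lt_pair_pair a b h) d

theorem isFormulaCode_iff {c : ℕ} : isFormulaCode c = true ↔ ∃ A : Formula, A.code = c := by
  constructor
  · intro h
    induction c using Nat.strong_induction_on with
    | _ c ih =>
      obtain ⟨t, r, rfl⟩ : ∃ t r, c = Nat.pair t r := ⟨_, _, (Nat.pair_unpair c).symm⟩
      obtain ⟨a, b, hab⟩ : ∃ a b, r = Nat.pair a b := ⟨_, _, (Nat.pair_unpair r).symm⟩
      rw [isFormulaCode, courseRec_eq] at h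
      rcases t with _ | _ | _ | _ | _ | t
      · simp at h
      · subst hab
        simp only [Nat.unpair_pair] at h
        have h : isTermCode a = true ∧ isTermCode b = true := by simpa using h
        obtain ⟨⟨s, rfl⟩, t, rfl⟩ := And.imp isTermCode_iff.1 isTermCode_iff.1 h
        exact ⟨.eq s t, rfl⟩
      · simp only [Nat.unpair_pair, getD_arg _ _ (Nat.succ_pos _)] at h
        rw [← isFormulaCode] at h
        obtain ⟨A, rfl⟩ := ih r (lt_pair _ (by omega)) (by simpa using h)
        exact ⟨.neg A, rfl⟩
      · subst hab
        simp only [Nat.unpair_pair, getD_left _ _ _ (Nat.succ_pos _),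
          getD_right _ _ _ (Nat.succ_pos _)] at h
        rw [← isFormulaCode] at h
        have h : isFormulaCode a = true ∧ isFormulaCode b = true := by simpa using h
        obtain ⟨A, rfl⟩ := ih a (left_lt_pair_pair _ _ (by omega)) h.1
        obtain ⟨B, rfl⟩ := ih b (right_lt_pair_pair _ _ (by omega)) h.2
        exact ⟨.imp A B, rfl⟩
      · subst hab
        simp only [Nat.unpair_pair, getD_right _ _ _ (Nat.succ_pos _)] at h
        rw [← isFormulaCode] at h
        obtain ⟨B, rfl⟩ := ih b (right_lt_pair_pair _ _ (by omega)) (by simpa using h)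
        exact ⟨.all a B, rfl⟩
      · simp at h
  · rintro ⟨A, rfl⟩
    induction A with
    | eq s t =>
      rw [isFormulaCode, courseRec_eq]
      simp [Formula.code, isTermCode_iff.2 ⟨_, rfl⟩]
    | neg A ih =>
      rw [isFormulaCode, courseRec_eq]
      simp only [Formula.code, Nat.unpair_pair, getD_arg _ _ (Nat.succ_pos _)]
      rw [← isFormulaCode]
      simp [ih]
    | imp A B ihA ihB =>
      rw [isFormulaCode, courseRec_eq]
      simp only [Formula.code, Nat.unpair_pair, getD_left _ _ _ (Nat.succ_pos _),
        getD_right _ _ _ (Nat.succ_pos _)]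
      rw [← isFormulaCode]
      simp [ihA, ihB]
    | all x A ih =>
      rw [isFormulaCode, courseRec_eq]
      simp only [Formula.code, Nat.unpair_pair, getD_right _ _ _ (Nat.succ_pos _)]
      rw [← isFormulaCode]
      simp [ih]

/-- The variable `x` is free in the formula with code `c`. -/
def freeCode : ℕ → ℕ → Bool :=
  courseRec fun x c (l : List Bool) =>
    bif c.unpair.1 == 1 then
      occursCode x c.unpair.2.unpair.1 || occursCode x c.unpair.2.unpair.2
    else bif c.unpair.1 == 2 then l.getD c.unpair.2 false
    else bif c.unpair.1 == 3 then
      l.getD c.unpair.2.unpair.1 false || l.getD c.unpair.2.unpair.2 false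
    else !(x == c.unpair.2.unpair.1) && l.getD c.unpair.2.unpair.2 false

@[fun_prop]
theorem primrec_freeCode {f g : α → ℕ} (hf : Primrec f) (hg : Primrec g) :
    Primrec fun a => freeCode (f a) (g a) :=
  primrec_courseRec (by fun_prop) hf hg

theorem freeCode_iff {x : ℕ} : freeCode x A.code = true ↔ A.Free x := by
  induction A with
  | eq s t =>
    rw [freeCode, courseRec_eq]
    simp [Formula.code, Formula.Free, occursCode_iff]
  | neg A ih =>
    rw [freeCode, courseRec_eq]
    simp only [Formula.code, Nat.unpair_pair, getD_arg _ _ (Nat.succ_pos _)]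
    exact ih
  | imp A B ihA ihB =>
    rw [freeCode, courseRec_eq]
    simp only [Formula.code, Nat.unpair_pair, getD_left _ _ _ (Nat.succ_pos _),
      getD_right _ _ _ (Nat.succ_pos _)]
    rw [← freeCode]
    simp [ihA, ihB, Formula.Free]
  | all y A ih =>
    rw [freeCode, courseRec_eq]
    simp only [Formula.code, Nat.unpair_pair, getD_right _ _ _ (Nat.succ_pos _)]
    rw [← freeCode]
    simp [ih, Formula.Free]

/-- Substitution of the term with code `a.2` for the variable `a.1` in a formula. -/
def substCode : ℕ × ℕ → ℕ → ℕ :=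
  courseRec fun a c (l : List ℕ) =>
    bif c.unpair.1 == 1 then Nat.pair 1 (Nat.pair (substTermCode a c.unpair.2.unpair.1)
      (substTermCode a c.unpair.2.unpair.2))
    else bif c.unpair.1 == 2 then Nat.pair 2 (l.getD c.unpair.2 0)
    else bif c.unpair.1 == 3 then
      Nat.pair 3 (Nat.pair (l.getD c.unpair.2.unpair.1 0) (l.getD c.unpair.2.unpair.2 0))
    else bif a.1 == c.unpair.2.unpair.1 then c
    else Nat.pair 4 (Nat.pair c.unpair.2.unpair.1 (l.getD c.unpair.2.unpair.2 0))

@[fun_prop]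
theorem primrec_substCode {f : α → ℕ × ℕ} {g : α → ℕ} (hf : Primrec f) (hg : Primrec g) :
    Primrec fun a => substCode (f a) (g a) :=
  primrec_courseRec (by fun_prop) hf hg

theorem substCode_eq (x : ℕ) (t : PRTerm) (A : Formula) :
    substCode (x, termCode t) A.code = (A.subst x t).code := by
  induction A with
  | eq s t =>
    rw [substCode, courseRec_eq]
    simp [Formula.code, Formula.subst, substTermCode_eq]
  | neg A ih =>
    rw [substCode, courseRec_eq]
    simp only [Formula.code, Nat.unpair_pair, getD_arg _ _ (Nat.succ_pos _)]
    rw [← substCode]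
    simp [ih, Formula.code, Formula.subst]
  | imp A B ihA ihB =>
    rw [substCode, courseRec_eq]
    simp only [Formula.code, Nat.unpair_pair, getD_left _ _ _ (Nat.succ_pos _),
      getD_right _ _ _ (Nat.succ_pos _)]
    rw [← substCode]
    simp [ihA, ihB, Formula.code, Formula.subst]
  | all y A ih =>
    rw [substCode, courseRec_eq]
    simp only [Formula.code, Nat.unpair_pair, getD_right _ _ _ (Nat.succ_pos _)]
    rw [← substCode]
    by_cases h : x = y
    · simp [h, Formula.code, Formula.subst]
    · simp [ih, h, Bool.cond_eq_ite, Formula.code, Formula.subst]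

/-- The term with code `a.2` is free for the variable `a.1` in the formula with code `c`. -/
def freeForCode : ℕ × ℕ → ℕ → Bool :=
  courseRec fun a c (l : List Bool) =>
    bif c.unpair.1 == 1 then true
    else bif c.unpair.1 == 2 then l.getD c.unpair.2 false
    else bif c.unpair.1 == 3 then
      l.getD c.unpair.2.unpair.1 false && l.getD c.unpair.2.unpair.2 false
    else !freeCode a.1 c ||
      (!occursCode c.unpair.2.unpair.1 a.2 && l.getD c.unpair.2.unpair.2 false)

@[fun_prop]
theorem primrec_freeForCode {f : α → ℕ × ℕ} {g : α → ℕ} (hf : Primrec f) (hg : Primrec g) :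
    Primrec fun a => freeForCode (f a) (g a) :=
  primrec_courseRec (by fun_prop) hf hg

theorem freeForCode_iff {x : ℕ} {t : PRTerm} :
    freeForCode (x, termCode t) A.code = true ↔ A.FreeFor x t := by
  induction A with
  | eq s t =>
    rw [freeForCode, courseRec_eq]
    simp [Formula.code, Formula.FreeFor]
  | neg A ih =>
    rw [freeForCode, courseRec_eq]
    simp only [Formula.code, Nat.unpair_pair, getD_arg _ _ (Nat.succ_pos _)]
    exact ih
  | imp A B ihA ihB =>
    rw [freeForCode, courseRec_eq]
    simp only [Formula.code, Nat.unpair_pair, getD_left _ _ _ (Nat.succ_pos _),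
      getD_right _ _ _ (Nat.succ_pos _)]
    rw [← freeForCode]
    simp [ihA, ihB, Formula.FreeFor]
  | all y A ih =>
    have h1 : (freeCode x (Formula.all y A).code = false) ↔ ¬ (Formula.all y A).Free x := by
      rw [← freeCode_iff, Bool.not_eq_true]
    have h2 : (occursCode y (termCode t) = false) ↔ y ∉ t.varFinset := by
      rw [← occursCode_iff, Bool.not_eq_true]
    rw [Formula.code] at h1
    rw [freeForCode, courseRec_eq]
    simp only [Formula.code, Nat.unpair_pair, getD_right _ _ _ (Nat.succ_pos _)]
    rw [← freeForCode]
    simp [ih, Formula.FreeFor, h1, h2]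

/-- The formula with code `c` is quantifier-free. -/
def quantifierFreeCode : ℕ → Bool :=
  courseRec (fun (_ : ℕ) c (l : List Bool) =>
    bif c.unpair.1 == 1 then true
    else bif c.unpair.1 == 2 then l.getD c.unpair.2 false
    else bif c.unpair.1 == 3 then
      l.getD c.unpair.2.unpair.1 false && l.getD c.unpair.2.unpair.2 false
    else false) 0

@[fun_prop]
theorem primrec_quantifierFreeCode {f : α → ℕ} (hf : Primrec f) :
    Primrec fun a => quantifierFreeCode (f a) :=
  primrec_courseRec (by fun_prop) (by fun_prop) hf

theorem quantifierFreeCode_iff : quantifierFreeCode A.code = true ↔ A.QuantifierFree := by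
  induction A with
  | eq s t =>
    rw [quantifierFreeCode, courseRec_eq]
    simp [Formula.code, Formula.QuantifierFree]
  | neg A ih =>
    rw [quantifierFreeCode, courseRec_eq]
    simp only [Formula.code, Nat.unpair_pair, getD_arg _ _ (Nat.succ_pos _)]
    exact ih
  | imp A B ihA ihB =>
    rw [quantifierFreeCode, courseRec_eq]
    simp only [Formula.code, Nat.unpair_pair, getD_left _ _ _ (Nat.succ_pos _),
      getD_right _ _ _ (Nat.succ_pos _)]
    rw [← quantifierFreeCode]
    simp [ihA, ihB, Formula.QuantifierFree]
  | all y A ih =>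
    rw [quantifierFreeCode, courseRec_eq]
    simp [Formula.code, Formula.QuantifierFree]

/-- The code of a numeral. -/
def numeralCode (n : ℕ) : ℕ := termCode (numeral n)

@[fun_prop]
theorem primrec_numeralCode {f : α → ℕ} (hf : Primrec f) :
    Primrec fun a => numeralCode (f a) := by
  refine Primrec.comp (f := numeralCode) ?_ hf
  -- The components are the tag of a function term, the arity `1`, the code of the successor symbol,
  -- and the code `Nat.pair c 0 + 1` of the one-element list `[c]`.
  refine (Primrec.nat_rec₁ (f := fun _ c => Nat.pair 2 (Nat.pair 1
    (Nat.pair (Nat.pair 2 0) (Nat.pair c 0 + 1)))) (termCode zeroT)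
    (Primrec₂.mk (by fun_prop))).of_eq fun n => ?_
  induction n with
  | zero => rfl
  | succ n ih =>
    have : numeralCode (n + 1) = Nat.pair 2 (Nat.pair 1
        (Nat.pair (Nat.pair 2 0) (Nat.pair (numeralCode n) 0 + 1))) := by
      simp [numeralCode, numeral, succT, app, termCode_func, PRSym.code]
    rw [this, ← ih]

/-! ## Bounds for searches -/

theorem le_termCode_of_mem {x : ℕ} {t : PRTerm} (h : x ∈ t.varFinset) : x ≤ termCode t := by
  induction t with
  | var i =>
    rw [mem_varFinset_var.1 h, termCode_var]
    exact Nat.right_le_pair _ _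
  | func f ts ih =>
    obtain ⟨i, hi⟩ := mem_varFinset_app.1 h
    exact (ih i hi).trans (termCode_lt_func f ts i).le

theorem termCode_le_subst {x : ℕ} {r : PRTerm} (t : PRTerm) (h : x ∈ r.varFinset) :
    termCode t ≤ termCode (r.subst (Function.update vr x t)) := by
  induction r with
  | var i =>
    obtain rfl := mem_varFinset_var.1 h
    change _ ≤ termCode (Function.update vr x t x)
    rw [Function.update_self]
  | func f ts ih =>
    obtain ⟨i, hi⟩ := mem_varFinset_app.1 h
    exact (ih i hi).trans
      (termCode_lt_func f (fun i => (ts i).subst (Function.update vr x t)) i).le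

namespace Formula

theorem Free.le_code {x : ℕ} (h : A.Free x) : x ≤ A.code := by
  induction A with
  | eq s t =>
    rcases h with h | h
    · exact (le_termCode_of_mem h).trans (left_lt_pair_pair _ _ (by omega)).le
    · exact (le_termCode_of_mem h).trans (right_lt_pair_pair _ _ (by omega)).le
  | neg A ih => exact (ih h).trans (lt_pair _ (by omega)).le
  | imp A B ihA ihB =>
    rcases h with h | h
    · exact (ihA h).trans (left_lt_pair_pair _ _ (by omega)).le
    · exact (ihB h).trans (right_lt_pair_pair _ _ (by omega)).le
  | all y A ih => exact (ih h.2).trans (right_lt_pair_pair _ _ (by omega)).le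

/-- An inserted term survives inside the result, so it can be searched for below the code of the
result. This bounds the search for the instantiating term of a quantifier axiom and for the numeral
in an instance. -/
theorem Free.termCode_le_subst {x : ℕ} (t : PRTerm) (h : A.Free x) :
    termCode t ≤ (A.subst x t).code := by
  induction A with
  | eq r s =>
    rcases h with h | h
    · exact (PRArith.termCode_le_subst t h).trans (left_lt_pair_pair _ _ (by omega)).le
    · exact (PRArith.termCode_le_subst t h).trans (right_lt_pair_pair _ _ (by omega)).le
  | neg A ih => exact (ih h).trans (lt_pair _ (by omega)).le
  | imp A B ihA ihB =>
    rcases h with h | h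
    · exact (ihA h).trans (left_lt_pair_pair _ _ (by omega)).le
    · exact (ihB h).trans (right_lt_pair_pair _ _ (by omega)).le
  | all y A ih =>
    rw [subst, if_neg h.1]
    exact (ih h.2).trans (right_lt_pair_pair _ _ (by omega)).le

/-- This covers the case where the bound above is unavailable: the inserted term then leaves no
trace and can be exchanged for a fixed small one. -/
theorem subst_of_not_free {x : ℕ} (t : PRTerm) (h : ¬ A.Free x) : A.subst x t = A := by
  have ht : ∀ r : PRTerm, x ∉ r.varFinset → r.subst (Function.update vr x t) = r := by
    intro r hr
    rw [term_subst_congr (τ := vr), term_subst_vr]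
    intro y hy
    rw [Function.update_of_ne]
    rintro rfl
    exact hr hy
  induction A with
  | eq r s =>
    rw [Free, not_or] at h
    rw [subst, ht r h.1, ht s h.2]
  | neg A ih => rw [subst, ih h]
  | imp A B ihA ihB =>
    rw [Free, not_or] at h
    rw [subst, ihA h.1, ihB h.2]
  | all y A ih =>
    by_cases hx : x = y
    · rw [subst, if_pos hx]
    · rw [subst, if_neg hx, ih fun hf => h ⟨hx, hf⟩]

theorem freeFor_of_not_free {x : ℕ} (t : PRTerm) (h : ¬ A.Free x) : A.FreeFor x t := by
  induction A with
  | eq r s => trivial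
  | neg A ih => exact ih h
  | imp A B ihA ihB =>
    rw [Free, not_or] at h
    exact ⟨ihA h.1, ihB h.2⟩
  | all y A ih => exact .inl h

end Formula

/-! ## Recognition of axioms and proofs -/

/-- The code of an identity. -/
def eqCode (s t : ℕ) : ℕ := Nat.pair 1 (Nat.pair s t)

/-- The code of a negation. -/
def negCode (a : ℕ) : ℕ := Nat.pair 2 a

/-- The code of a conditional. -/
def impCode (a b : ℕ) : ℕ := Nat.pair 3 (Nat.pair a b)

/-- The code of a universal quantification. -/
def allCode (x a : ℕ) : ℕ := Nat.pair 4 (Nat.pair x a)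

variable {f g : α → ℕ}

@[fun_prop]
theorem primrec_eqCode (hf : Primrec f) (hg : Primrec g) :
    Primrec fun a => eqCode (f a) (g a) := by
  unfold eqCode
  fun_prop

@[fun_prop]
theorem primrec_negCode (hf : Primrec f) : Primrec fun a => negCode (f a) := by
  unfold negCode
  fun_prop

@[fun_prop]
theorem primrec_impCode (hf : Primrec f) (hg : Primrec g) :
    Primrec fun a => impCode (f a) (g a) := by
  unfold impCode
  fun_prop

@[fun_prop]
theorem primrec_allCode (hf : Primrec f) (hg : Primrec g) :
    Primrec fun a => allCode (f a) (g a) := by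
  unfold allCode
  fun_prop

theorem code_eq (s t : PRTerm) : (Formula.eq s t).code = eqCode (termCode s) (termCode t) := rfl

theorem code_neg (A : Formula) : A.neg.code = negCode A.code := rfl

theorem code_imp (A B : Formula) : (A.imp B).code = impCode A.code B.code := rfl

theorem code_all (x : ℕ) (A : Formula) : (Formula.all x A).code = allCode x A.code := rfl

theorem exists_of_code_eq_eqCode {s t : ℕ} (h : A.code = eqCode s t) :
    ∃ s' t', A = .eq s' t' ∧ termCode s' = s ∧ termCode t' = t := by
  cases A <;> simp [Formula.code, eqCode] at h
  exact ⟨_, _, rfl, h.1, h.2⟩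

theorem exists_of_code_eq_negCode {a : ℕ} (h : A.code = negCode a) :
    ∃ B, A = .neg B ∧ B.code = a := by
  cases A <;> simp [Formula.code, negCode] at h
  exact ⟨_, rfl, h⟩

theorem exists_of_code_eq_impCode {a b : ℕ} (h : A.code = impCode a b) :
    ∃ B C, A = .imp B C ∧ B.code = a ∧ C.code = b := by
  cases A <;> simp [Formula.code, impCode] at h
  exact ⟨_, _, rfl, h.1, h.2⟩

theorem exists_of_code_eq_allCode {x a : ℕ} (h : A.code = allCode x a) :
    ∃ B, A = .all x B ∧ B.code = a := by
  cases A <;> simp [Formula.code, allCode] at h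
  obtain ⟨rfl, h⟩ := h
  exact ⟨_, rfl, h⟩

end FormulaCodes

section ProofCodes

/-- The first immediate constituent of a code. -/
def fstCode (c : ℕ) : ℕ := c.unpair.2.unpair.1

/-- The second immediate constituent of a code. -/
def sndCode (c : ℕ) : ℕ := c.unpair.2.unpair.2

section

variable {α : Type*} [Primcodable α] {f : α → ℕ}

@[fun_prop]
theorem primrec_fstCode (hf : Primrec f) : Primrec fun a => fstCode (f a) := by
  unfold fstCode
  fun_prop

@[fun_prop]
theorem primrec_sndCode (hf : Primrec f) : Primrec fun a => sndCode (f a) := by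
  unfold sndCode
  fun_prop

end

@[simp] theorem fstCode_eqCode (a b : ℕ) : fstCode (eqCode a b) = a := by simp [fstCode, eqCode]

@[simp] theorem sndCode_eqCode (a b : ℕ) : sndCode (eqCode a b) = b := by simp [sndCode, eqCode]

@[simp] theorem fstCode_impCode (a b : ℕ) : fstCode (impCode a b) = a := by
  simp [fstCode, impCode]

@[simp] theorem sndCode_impCode (a b : ℕ) : sndCode (impCode a b) = b := by
  simp [sndCode, impCode]

@[simp] theorem fstCode_allCode (a b : ℕ) : fstCode (allCode a b) = a := by
  simp [fstCode, allCode]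

@[simp] theorem sndCode_allCode (a b : ℕ) : sndCode (allCode a b) = b := by
  simp [sndCode, allCode]

@[simp] theorem unpair_negCode (a : ℕ) : (negCode a).unpair.2 = a := by simp [negCode]

/-- The code of an instance of the first propositional axiom scheme. -/
def isAxiomK (c : ℕ) : Bool :=
  c == impCode (fstCode c) (impCode (fstCode (sndCode c)) (fstCode c))

/-- The code of an instance of the second propositional axiom scheme. -/
def isAxiomS (c : ℕ) : Bool :=
  (fun a b d => c == impCode (impCode a (impCode b d)) (impCode (impCode a b) (impCode a d)))
    (fstCode (fstCode c)) (fstCode (sndCode (fstCode c))) (sndCode (sndCode (fstCode c)))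

/-- The code of an instance of the contraposition axiom scheme. -/
def isAxiomContra (c : ℕ) : Bool :=
  (fun a b => c == impCode (impCode (negCode a) (negCode b)) (impCode b a))
    (sndCode (sndCode c)) (fstCode (sndCode c))

/-- The code of an instance of the instantiation axiom scheme. -/
def isAxiomInst (c : ℕ) : Bool :=
  c == impCode (allCode (fstCode (fstCode c)) (sndCode (fstCode c))) (sndCode c) &&
    (List.range (c + 3)).any fun t => isTermCode t &&
      (freeForCode (fstCode (fstCode c), t) (sndCode (fstCode c)) &&
        sndCode c == substCode (fstCode (fstCode c), t) (sndCode (fstCode c)))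

/-- The code of an instance of the distribution axiom scheme. -/
def isAxiomDist (c : ℕ) : Bool :=
  (fun x a b => c == impCode (allCode x (impCode a b)) (impCode a (allCode x b)) &&
    !freeCode x a)
    (fstCode (fstCode c)) (fstCode (sndCode (fstCode c))) (sndCode (sndCode (fstCode c)))

/-- The code of an instance of the reflexivity axiom scheme. -/
def isAxiomEqRefl (c : ℕ) : Bool := c == eqCode (fstCode c) (fstCode c)

/-- The code of an instance of the axiom scheme of replacement of equals. -/
def isAxiomEqSubst (c : ℕ) : Bool :=
  (fun x t a => c == impCode (eqCode (Nat.pair 1 x) t) (impCode a (substCode (x, t) a)) &&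
    freeForCode (x, t) a)
    (fstCode (fstCode c)).unpair.2 (sndCode (fstCode c)) (fstCode (sndCode c))

/-- The code of a logical axiom. -/
def isLogicalAxiomCode (c : ℕ) : Bool :=
  isAxiomK c || (isAxiomS c || (isAxiomContra c || (isAxiomInst c || (isAxiomDist c ||
    (isAxiomEqRefl c || isAxiomEqSubst c)))))

@[fun_prop]
theorem primrec_isLogicalAxiomCode {α : Type*} [Primcodable α] {f : α → ℕ} (hf : Primrec f) :
    Primrec fun a => isLogicalAxiomCode (f a) := by
  refine Primrec.comp (f := isLogicalAxiomCode) ?_ hf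
  unfold isLogicalAxiomCode isAxiomK isAxiomS isAxiomContra isAxiomInst isAxiomDist isAxiomEqRefl
    isAxiomEqSubst
  fun_prop

theorem isAxiomK_iff : isAxiomK A.code = true ↔ ∃ B C, A = .imp B (.imp C B) := by
  rw [isAxiomK, beq_iff_eq]
  constructor
  · intro h
    obtain ⟨B, D, rfl, h1, h2⟩ := exists_of_code_eq_impCode h
    obtain ⟨C, B', rfl, -, h3⟩ := exists_of_code_eq_impCode h2
    obtain rfl := Formula.code_injective (h1.trans h3.symm)
    exact ⟨B, C, rfl⟩
  · rintro ⟨B, C, rfl⟩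
    simp [code_imp]

theorem isAxiomS_iff : isAxiomS A.code = true ↔ ∃ B C D,
    A = .imp (.imp B (.imp C D)) (.imp (.imp B C) (.imp B D)) := by
  rw [isAxiomS, beq_iff_eq]
  constructor
  · intro h
    -- The code is named so that its projections stay fixed while `A` is taken apart.
    generalize hA : A.code = c at h
    rw [h] at hA
    obtain ⟨A₁, A₂, rfl, h1, h2⟩ := exists_of_code_eq_impCode hA
    obtain ⟨B, A₃, rfl, hB, h3⟩ := exists_of_code_eq_impCode h1
    obtain ⟨C, D, rfl, hC, hD⟩ := exists_of_code_eq_impCode h3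
    refine ⟨B, C, D, ?_⟩
    apply Formula.code_injective
    rw [hA]
    simp only [code_imp, hB, hC, hD]
  · rintro ⟨B, C, D, rfl⟩
    simp [code_imp]

theorem isAxiomContra_iff : isAxiomContra A.code = true ↔ ∃ B C,
    A = .imp (.imp (.neg B) (.neg C)) (.imp C B) := by
  rw [isAxiomContra, beq_iff_eq]
  constructor
  · intro h
    generalize hA : A.code = c at h
    rw [h] at hA
    obtain ⟨A₁, A₂, rfl, h1, h2⟩ := exists_of_code_eq_impCode hA
    obtain ⟨C, B, rfl, hC, hB⟩ := exists_of_code_eq_impCode h2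
    refine ⟨B, C, ?_⟩
    apply Formula.code_injective
    rw [hA]
    simp only [code_imp, code_neg, hB, hC]
  · rintro ⟨B, C, rfl⟩
    simp [code_imp, code_neg]

theorem isAxiomInst_iff : isAxiomInst A.code = true ↔ ∃ x t B, Formula.FreeFor x t B ∧
    A = .imp (.all x B) (B.subst x t) := by
  simp only [isAxiomInst, Bool.and_eq_true, beq_iff_eq, List.any_eq_true, List.mem_range,
    isTermCode_iff]
  constructor
  · rintro ⟨h, _, -, ⟨t, rfl⟩, hfree, hsub⟩
    generalize hA : A.code = c at h hfree hsub
    rw [h] at hA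
    obtain ⟨A₁, A₂, rfl, h1, h2⟩ := exists_of_code_eq_impCode hA
    obtain ⟨B, rfl, hB⟩ := exists_of_code_eq_allCode h1
    rw [← hB, freeForCode_iff] at hfree
    refine ⟨_, t, B, hfree, ?_⟩
    congr 1
    apply Formula.code_injective
    rw [← substCode_eq, h2, hsub, hB]
  · rintro ⟨x, t, B, hfree, rfl⟩
    simp only [code_imp, code_all, fstCode_impCode, sndCode_impCode, fstCode_allCode,
      sndCode_allCode, true_and]
    by_cases hx : B.Free x
    · refine ⟨_, ?_, ⟨t, rfl⟩, freeForCode_iff.2 hfree, (substCode_eq x t B).symm⟩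
      have h1 := hx.termCode_le_subst t
      have h2 : (B.subst x t).code ≤ impCode (allCode x B.code) (B.subst x t).code :=
        (right_lt_pair_pair _ _ (by omega)).le
      omega
    · refine ⟨_, ?_, ⟨vr 0, rfl⟩, freeForCode_iff.2 (Formula.freeFor_of_not_free _ hx), ?_⟩
      · have : termCode (vr 0) = 2 := rfl
        omega
      · rw [substCode_eq, Formula.subst_of_not_free _ hx, Formula.subst_of_not_free _ hx]

theorem isAxiomDist_iff : isAxiomDist A.code = true ↔ ∃ x B C, ¬ Formula.Free x B ∧
    A = .imp (.all x (.imp B C)) (.imp B (.all x C)) := by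
  simp only [isAxiomDist, Bool.and_eq_true, beq_iff_eq, Bool.not_eq_true']
  constructor
  · rintro ⟨h, hx⟩
    generalize hA : A.code = c at h hx
    rw [h] at hA
    obtain ⟨A₁, A₂, rfl, h1, h2⟩ := exists_of_code_eq_impCode hA
    obtain ⟨B, D, rfl, hB, h3⟩ := exists_of_code_eq_impCode h2
    obtain ⟨C, rfl, hC⟩ := exists_of_code_eq_allCode h3
    refine ⟨fstCode (fstCode c), B, C, ?_, ?_⟩
    · rw [← freeCode_iff, hB, hx]
      simp
    · apply Formula.code_injective
      rw [hA]
      simp only [code_imp, code_all, hB, hC]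
  · rintro ⟨x, B, C, hx, rfl⟩
    rw [← freeCode_iff, Bool.not_eq_true] at hx
    simp [code_imp, code_all, hx]

theorem isAxiomEqRefl_iff : isAxiomEqRefl A.code = true ↔ ∃ t, A = .eq t t := by
  rw [isAxiomEqRefl, beq_iff_eq]
  constructor
  · intro h
    generalize hA : A.code = c at h
    rw [h] at hA
    obtain ⟨s, t, rfl, h1, h2⟩ := exists_of_code_eq_eqCode hA
    obtain rfl := termCode_injective (h1.trans h2.symm)
    exact ⟨s, rfl⟩
  · rintro ⟨t, rfl⟩
    simp [code_eq]

/-- No search is needed here, in contrast to instantiation: the term is displayed in the antecedent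
`x = t`. -/
theorem isAxiomEqSubst_iff : isAxiomEqSubst A.code = true ↔ ∃ x t B, Formula.FreeFor x t B ∧
    A = .imp (.eq (vr x) t) (.imp B (B.subst x t)) := by
  simp only [isAxiomEqSubst, Bool.and_eq_true, beq_iff_eq]
  constructor
  · rintro ⟨h, hfree⟩
    generalize hA : A.code = c at h hfree
    rw [h] at hA
    obtain ⟨A₁, A₂, rfl, h1, h2⟩ := exists_of_code_eq_impCode hA
    obtain ⟨s, t, rfl, hs, ht⟩ := exists_of_code_eq_eqCode h1
    obtain ⟨B, C, rfl, hB, hC⟩ := exists_of_code_eq_impCode h2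
    rw [← ht, ← hB, freeForCode_iff] at hfree
    refine ⟨_, t, B, hfree, ?_⟩
    apply Formula.code_injective
    rw [hA]
    simp only [code_imp, code_eq, ← substCode_eq, hB, ht]
    rfl
  · rintro ⟨x, t, B, hfree, rfl⟩
    simp [code_imp, code_eq, termCode_var, substCode_eq, freeForCode_iff, hfree]

theorem isLogicalAxiomCode_iff : isLogicalAxiomCode A.code = true ↔ LogicalAxiom A := by
  simp only [isLogicalAxiomCode, Bool.or_eq_true, isAxiomK_iff, isAxiomS_iff, isAxiomContra_iff,
    isAxiomInst_iff, isAxiomDist_iff, isAxiomEqRefl_iff, isAxiomEqSubst_iff]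
  constructor
  · rintro (⟨B, C, rfl⟩ | ⟨B, C, D, rfl⟩ | ⟨B, C, rfl⟩ | ⟨x, t, B, h, rfl⟩ | ⟨x, B, C, h, rfl⟩ |
      ⟨t, rfl⟩ | ⟨x, t, B, h, rfl⟩)
    · exact .k B C
    · exact .s B C D
    · exact .contra B C
    · exact .inst x t B h
    · exact .dist x B C h
    · exact .eqRefl t
    · exact .eqSubst x t B h
  · rintro (⟨B, C⟩ | ⟨B, C, D⟩ | ⟨B, C⟩ | ⟨x, t, B, h⟩ | ⟨x, B, C, h⟩ | t | ⟨x, t, B, h⟩)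
    · exact .inl ⟨B, C, rfl⟩
    · exact .inr (.inl ⟨B, C, D, rfl⟩)
    · exact .inr (.inr (.inl ⟨B, C, rfl⟩))
    · exact .inr (.inr (.inr (.inl ⟨x, t, B, h, rfl⟩)))
    · exact .inr (.inr (.inr (.inr (.inl ⟨x, B, C, h, rfl⟩))))
    · exact .inr (.inr (.inr (.inr (.inr (.inl ⟨t, rfl⟩)))))
    · exact .inr (.inr (.inr (.inr (.inr (.inr ⟨x, t, B, h, rfl⟩)))))

/-- The list of codes is a proof whose non-logical axioms are recognized by `ax`. -/
def isProofList (ax : ℕ → Bool) (l : List ℕ) : Bool :=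
  l.all isFormulaCode && (List.range l.length).all fun i =>
    ax (l.getD i 0) || (isLogicalAxiomCode (l.getD i 0) ||
    (((List.range i).any fun j => (List.range i).any fun k =>
      l.getD k 0 == impCode (l.getD j 0) (l.getD i 0)) ||
    (List.range i).any fun j => l.getD i 0 == allCode (fstCode (l.getD i 0)) (l.getD j 0)))

theorem isProofList_map_code {ax : ℕ → Bool} (hax : ∀ A : Formula, ax A.code = true ↔ A ∈ S)
    (L : List Formula) : isProofList ax (L.map Formula.code) = true ↔ IsProof S L := by
  have hall : (L.map Formula.code).all isFormulaCode = true := by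
    simp [isFormulaCode_iff]
  have hget : ∀ i (h : i < L.length), (L.map Formula.code).getD i 0 = L[i].code := by
    intro i h
    simp [h]
  simp only [isProofList, hall, Bool.true_and, List.all_eq_true, List.mem_range, List.length_map,
    Bool.or_eq_true, List.any_eq_true, beq_iff_eq]
  have key : ∀ i (hi : i < L.length), (ax ((L.map Formula.code).getD i 0) = true ∨
      isLogicalAxiomCode ((L.map Formula.code).getD i 0) = true ∨
      (∃ j < i, ∃ k < i, (L.map Formula.code).getD k 0 =
        impCode ((L.map Formula.code).getD j 0) ((L.map Formula.code).getD i 0)) ∨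
      ∃ j < i, (L.map Formula.code).getD i 0 =
        allCode (fstCode ((L.map Formula.code).getD i 0)) ((L.map Formula.code).getD j 0)) ↔
      (L[i] ∈ S ∨ LogicalAxiom L[i] ∨
        (∃ j k : ℕ, j < i ∧ k < i ∧ ∃ B : Formula, L[j]? = some B ∧ L[k]? = some (B.imp L[i])) ∨
        (∃ j : ℕ, j < i ∧ ∃ (x : ℕ) (B : Formula), L[j]? = some B ∧
          L[i] = Formula.all x B)) := by
    intro i hi
    rw [hget i hi, hax, isLogicalAxiomCode_iff]
    refine or_congr_right (or_congr_right (or_congr ?_ ?_))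
    · constructor
      · rintro ⟨j, hj, k, hk, h⟩
        rw [hget j (hj.trans hi), hget k (hk.trans hi), ← code_imp] at h
        refine ⟨j, k, hj, hk, _, List.getElem?_eq_getElem (hj.trans hi), ?_⟩
        rw [List.getElem?_eq_getElem (hk.trans hi), Formula.code_injective h]
      · rintro ⟨j, k, hj, hk, B, h1, h2⟩
        rw [List.getElem?_eq_getElem (hj.trans hi), Option.some_inj] at h1
        rw [List.getElem?_eq_getElem (hk.trans hi), Option.some_inj] at h2
        refine ⟨j, hj, k, hk, ?_⟩
        rw [hget j (hj.trans hi), hget k (hk.trans hi), h1, h2, code_imp]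
    · constructor
      · rintro ⟨j, hj, h⟩
        rw [hget j (hj.trans hi), ← code_all] at h
        -- The generalized variable is the one read off the code of the line itself.
        exact ⟨j, hj, _, _, List.getElem?_eq_getElem (hj.trans hi), Formula.code_injective h⟩
      · rintro ⟨j, hj, x, B, h1, h2⟩
        rw [List.getElem?_eq_getElem (hj.trans hi), Option.some_inj] at h1
        refine ⟨j, hj, ?_⟩
        rw [hget j (hj.trans hi), h1, h2, code_all, fstCode_allCode]
  constructor
  · intro h i A hA
    obtain ⟨hi, rfl⟩ := List.getElem?_eq_some_iff.1 hA
    exact (key i hi).1 (h i hi)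
  · intro h i hi
    exact (key i hi).2 (h i _ (List.getElem?_eq_getElem hi))

/-- The last entry of the list with a given code. -/
def lastCode (p : ℕ) : ℕ := (decodeList p).getD ((decodeList p).length - 1) 0

/-- Thus the default value `0` of `lastCode` at the empty list cannot be mistaken for a last line.
-/
theorem Formula.code_pos (A : Formula) : 0 < A.code := by
  cases A <;> exact Nat.zero_lt_of_lt (lt_pair _ (by omega))

theorem proves_iff {ax : ℕ → Bool} (hax : ∀ A : Formula, ax A.code = true ↔ A ∈ S) {p : ℕ} :
    Proves S p A ↔ isProofList ax (decodeList p) = true ∧ lastCode p = A.code := by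
  have hlast : ∀ L : List Formula, lastCode (seqCode L) = A.code ↔ L.getLast? = some A := by
    intro L
    rw [lastCode, seqCode, decodeList_encode, List.getLast?_eq_getElem?, List.length_map]
    rcases L.eq_nil_or_concat with rfl | ⟨M, B, rfl⟩
    · simpa using A.code_pos.ne
    · simp [Formula.code_injective.eq_iff]
  constructor
  · rintro ⟨L, rfl, hL, hA⟩
    refine ⟨?_, (hlast L).2 hA⟩
    rw [seqCode, decodeList_encode, isProofList_map_code hax]
    exact hL
  · rintro ⟨hp, hA⟩
    -- Every number codes some list of numbers; the test that all entries are codes of formulas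
    -- turns that list into a list of formulas.
    obtain ⟨L, hL⟩ : ∃ L : List Formula, L.map Formula.code = decodeList p := by
      have : ∀ b ∈ decodeList p, b ∈ Set.range Formula.code := by
        rw [isProofList, Bool.and_eq_true, List.all_eq_true] at hp
        exact fun b hb => isFormulaCode_iff.1 (hp.1 b hb)
      exact (Set.mem_range (f := List.map Formula.code)).1 (by
        rw [Set.range_list_map]; exact this)
    have hpL : seqCode L = p := by rw [seqCode, hL, encode_decodeList]
    subst hpL
    rw [← hL, isProofList_map_code hax] at hp
    exact ⟨L, rfl, hp, (hlast L).1 hA⟩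

/-- The number `a` is the code of a quantifier-free formula in at most the distinct variables `x`
and `y`. -/
def isTwoMatrixCode (x y a : ℕ) : Bool :=
  !(x == y) && (quantifierFreeCode a &&
    (List.range (a + 1)).all fun z => !freeCode z a || (z == x || z == y))

theorem isTwoMatrixCode_iff {x y : ℕ} : isTwoMatrixCode x y A.code = true ↔ IsTwoMatrix x y A := by
  simp only [isTwoMatrixCode, Bool.and_eq_true, Bool.not_eq_true',
    quantifierFreeCode_iff, List.all_eq_true, List.mem_range, Bool.or_eq_true, beq_iff_eq,
    ← Bool.not_eq_true, freeCode_iff]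
  constructor
  · rintro ⟨h1, h2, h3⟩
    exact ⟨h1, h2, fun z hz => (h3 z (Nat.lt_succ_of_le hz.le_code)).resolve_left fun h => h hz⟩
  · rintro ⟨h1, h2, h3⟩
    exact ⟨h1, h2, fun z _ => or_iff_not_imp_left.2 fun h => h3 z (not_not.1 h)⟩

/-- The first variable of the `Π⁰₂` sentence with code `c`. -/
def outerVar (c : ℕ) : ℕ := fstCode c

/-- The second variable of the `Π⁰₂` sentence with code `c`. -/
def innerVar (c : ℕ) : ℕ := fstCode (sndCode c).unpair.2

/-- The matrix of the `Π⁰₂` sentence with code `c`. -/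
def matrixCode (c : ℕ) : ℕ := (sndCode (sndCode c).unpair.2).unpair.2

/-- The number is the code of a `Π⁰₂` sentence. -/
def isPiTwoCode (c : ℕ) : Bool :=
  c == allCode (outerVar c) (negCode (allCode (innerVar c) (negCode (matrixCode c)))) &&
    isTwoMatrixCode (outerVar c) (innerVar c) (matrixCode c)

theorem code_all_ex (x y : ℕ) (A : Formula) :
    (Formula.all x (Formula.ex y A)).code =
      allCode x (negCode (allCode y (negCode A.code))) := rfl

theorem outerVar_code (x y : ℕ) (A : Formula) :
    outerVar (Formula.all x (Formula.ex y A)).code = x := by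
  simp [code_all_ex, outerVar]

theorem innerVar_code (x y : ℕ) (A : Formula) :
    innerVar (Formula.all x (Formula.ex y A)).code = y := by
  simp [code_all_ex, innerVar]

theorem matrixCode_code (x y : ℕ) (A : Formula) :
    matrixCode (Formula.all x (Formula.ex y A)).code = A.code := by
  simp [code_all_ex, matrixCode]

theorem isPiTwoCode_iff : isPiTwoCode B.code = true ↔
    ∃ x y A, IsTwoMatrix x y A ∧ B = Formula.all x (Formula.ex y A) := by
  constructor
  · intro h
    rw [isPiTwoCode, Bool.and_eq_true, beq_iff_eq] at h
    obtain ⟨h, hm⟩ := h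
    obtain ⟨B₁, hB, h1⟩ := exists_of_code_eq_allCode h
    obtain ⟨B₂, rfl, h2⟩ := exists_of_code_eq_negCode h1
    obtain ⟨B₃, rfl, h3⟩ := exists_of_code_eq_allCode h2
    obtain ⟨A, rfl, h4⟩ := exists_of_code_eq_negCode h3
    rw [← h4, isTwoMatrixCode_iff] at hm
    exact ⟨_, _, A, hm, hB⟩
  · rintro ⟨x, y, A, hA, rfl⟩
    rw [isPiTwoCode, outerVar_code, innerVar_code, matrixCode_code, isTwoMatrixCode_iff.2 hA,
      code_all_ex]
    simp

/-- The number `p` codes a proof of a `Π⁰₂` sentence. -/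
def provesPiTwoCode (ax : ℕ → Bool) (p : ℕ) : Bool :=
  isProofList ax (decodeList p) && isPiTwoCode (lastCode p)

/-- The number `p` codes a proof of a `Π⁰₂` sentence, and `q` a proof of an instance of it for
the numeral of `p`. -/
def provesInstanceCode (ax : ℕ → Bool) (p q : ℕ) : Bool :=
  provesPiTwoCode ax p && (isProofList ax (decodeList q) && (List.range (q + 1)).any fun n =>
    lastCode q == substCode (innerVar (lastCode p), numeralCode n)
      (substCode (outerVar (lastCode p), numeralCode p) (matrixCode (lastCode p))))

theorem exists_lastCode_eq_of_isProofList {ax : ℕ → Bool} {p : ℕ}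
    (h : isProofList ax (decodeList p) = true) (hp : lastCode p ≠ 0) :
    ∃ A : Formula, A.code = lastCode p := by
  rw [isProofList, Bool.and_eq_true, List.all_eq_true] at h
  refine isFormulaCode_iff.1 (h.1 _ ?_)
  rw [lastCode] at hp ⊢
  by_cases hl : (decodeList p).length - 1 < (decodeList p).length
  · rw [List.getD_eq_getElem _ _ hl]
    exact List.getElem_mem _
  · rw [List.getD_eq_default _ _ (by omega)] at hp
    exact (hp rfl).elim

theorem provesPiTwoCode_iff {ax : ℕ → Bool} (hax : ∀ A : Formula, ax A.code = true ↔ A ∈ S)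
    {p : ℕ} : provesPiTwoCode ax p = true ↔ ProvesPiTwo S p := by
  rw [provesPiTwoCode, Bool.and_eq_true]
  constructor
  · rintro ⟨h1, h2⟩
    obtain ⟨B, hB⟩ := exists_lastCode_eq_of_isProofList h1 (fun h0 => by
      rw [h0, isPiTwoCode, Bool.and_eq_true, beq_iff_eq] at h2
      exact (Nat.zero_lt_of_lt (lt_pair _ (by omega))).ne h2.1)
    rw [← hB, isPiTwoCode_iff] at h2
    obtain ⟨x, y, A, hA, rfl⟩ := h2
    exact ⟨x, y, A, hA, (proves_iff hax).2 ⟨h1, hB.symm⟩⟩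
  · rintro ⟨x, y, A, hA, hp⟩
    obtain ⟨h1, h2⟩ := (proves_iff hax).1 hp
    exact ⟨h1, by rw [h2, isPiTwoCode_iff]; exact ⟨x, y, A, hA, rfl⟩⟩

theorem provesInstanceCode_iff {ax : ℕ → Bool} (hax : ∀ A : Formula, ax A.code = true ↔ A ∈ S)
    {p q : ℕ} : provesInstanceCode ax p q = true ↔ ProvesInstance S p q := by
  rw [provesInstanceCode, Bool.and_eq_true, provesPiTwoCode_iff hax, Bool.and_eq_true,
    List.any_eq_true]
  have key : ∀ {x y A}, Proves S p (Formula.all x (Formula.ex y A)) → ∀ n,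
      substCode (innerVar (lastCode p), numeralCode n)
      (substCode (outerVar (lastCode p), numeralCode p) (matrixCode (lastCode p))) =
      ((A.subst x (numeral p)).subst y (numeral n)).code := by
    intro x y A hp n
    rw [((proves_iff hax).1 hp).2, innerVar_code, outerVar_code, matrixCode_code, numeralCode,
      numeralCode, substCode_eq, substCode_eq]
  constructor
  · rintro ⟨⟨x, y, A, hA, hp⟩, h1, n, -, h2⟩
    rw [key hp, beq_iff_eq] at h2
    exact ⟨x, y, A, hA, hp, n, (proves_iff hax).2 ⟨h1, h2⟩⟩
  · rintro ⟨x, y, A, hA, hp, n, hq⟩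
    refine ⟨⟨x, y, A, hA, hp⟩, ((proves_iff hax).1 hq).1, ?_⟩
    -- If `y` occurs in `A(p,y)`, the numeral is part of the last line of `q`, whence `n < q`.
    -- Otherwise all instances coincide and `0` serves in place of `n`.
    by_cases hy : (A.subst x (numeral p)).Free y
    · refine ⟨n, ?_, ?_⟩
      · have h1 := le_termCode_numeral n
        have h2 := hy.termCode_le_subst (numeral n)
        have h3 := hq.code_lt
        rw [List.mem_range]
        omega
      · rw [key hp, ((proves_iff hax).1 hq).2, beq_self_eq_true]
    · refine ⟨0, List.mem_range.2 (by omega), ?_⟩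
      rw [key hp, ((proves_iff hax).1 hq).2, Formula.subst_of_not_free _ hy,
        Formula.subst_of_not_free _ hy, beq_self_eq_true]

/-! ### Primitive recursiveness of the proof predicates -/

section

variable {α : Type*} [Primcodable α] {f : α → ℕ} {ax : ℕ → Bool}

theorem primrec_isProofList (hax : Primrec ax) :
    Primrec fun p => isProofList ax (decodeList p) := by
  unfold isProofList
  fun_prop

@[fun_prop]
theorem primrec_lastCode (hf : Primrec f) : Primrec fun a => lastCode (f a) := by
  unfold lastCode
  fun_prop

@[fun_prop]
theorem primrec_isPiTwoCode (hf : Primrec f) : Primrec fun a => isPiTwoCode (f a) := by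
  unfold isPiTwoCode isTwoMatrixCode outerVar innerVar matrixCode
  fun_prop

theorem primrec_provesPiTwoCode (hax : Primrec ax) : Primrec (provesPiTwoCode ax) := by
  have := primrec_isProofList hax
  unfold provesPiTwoCode
  fun_prop

theorem primrec_provesInstanceCode (hax : Primrec ax) :
    Primrec fun p : ℕ × ℕ => provesInstanceCode ax p.1 p.2 := by
  have h1 : Primrec fun p : ℕ × ℕ => provesPiTwoCode ax p.1 :=
    (primrec_provesPiTwoCode hax).comp Primrec.fst
  have h2 : Primrec fun p : ℕ × ℕ => isProofList ax (decodeList p.2) :=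
    (primrec_isProofList hax).comp Primrec.snd
  unfold provesInstanceCode outerVar innerVar matrixCode
  fun_prop

end

theorem exists_primrec_axioms (hS : IsPRArithmetic S) :
    ∃ ax : ℕ → Bool, Primrec ax ∧ ∀ A : Formula, ax A.code = true ↔ A ∈ S := by
  classical
  refine ⟨fun n => decide (∃ A ∈ S, A.code = n), hS.primrec_axioms.decide, fun A => ?_⟩
  rw [decide_eq_true_iff]
  exact ⟨fun ⟨B, hB, h⟩ => Formula.code_injective h ▸ hB, fun h => ⟨A, h, rfl⟩⟩

theorem exists_definesProvesPiTwo (hS : IsPRArithmetic S) :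
    ∃ f : PRSym 1, DefinesProvesPiTwo S f := by
  obtain ⟨ax, h1, h2⟩ := exists_primrec_axioms hS
  obtain ⟨f, hf⟩ := exists_eval_one (primrec_provesPiTwoCode h1)
  exact ⟨f, fun p => (hf p).trans (provesPiTwoCode_iff h2)⟩

theorem exists_definesProvesInstance (hS : IsPRArithmetic S) :
    ∃ g : PRSym 2, DefinesProvesInstance S g := by
  obtain ⟨ax, h1, h2⟩ := exists_primrec_axioms hS
  obtain ⟨g, hg⟩ := exists_eval_two (primrec_provesInstanceCode h1)
  exact ⟨g, fun p q => (hg p q).trans (provesInstanceCode_iff h2)⟩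

end ProofCodes

end PRArith

theorem mainTheorem1 (S : Set PRArith.Formula) (hS : IsPRArithmetic S) :
    (OneConsistent S ↔ SigmaOneCorrect S) ∧
    (∃ f : PRSym 1, DefinesProvesPiTwo S f) ∧
    (∃ g : PRSym 2, DefinesProvesInstance S g) ∧
    ∀ (f : PRSym 1) (g : PRSym 2), DefinesProvesPiTwo S f → DefinesProvesInstance S g →
      (OneConsistent S → (starSentence f g).IsTrue ∧ ¬ Provable S (starSentence f g)) ∧
      (¬ Consistent S → (starSentence f g).IsTrue) ∧
      (OneConsistent S ∨ ¬ Consistent S → ∀ m : ℕ, Provable S (starInstance f g m)) ∧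
      (TwoConsistent S → ¬ Provable S (starSentence f g) ∧ ¬ Provable S (starSentence f g).neg) ∧
      (OmegaConsistent S → ¬ Provable S (starSentence f g) ∧ ¬ Provable S (starSentence f g).neg) := by
  have hb := hS.proves_basic
  refine ⟨oneConsistent_iff_sigmaOneCorrect hb, exists_definesProvesPiTwo hS,
    exists_definesProvesInstance hS, fun f g hf hg => ?_⟩
  have two (h : TwoConsistent S) :
      ¬ Provable S (starSentence f g) ∧ ¬ Provable S (starSentence f g).neg :=
    ⟨not_provable_starSentence hb hf hg h.oneConsistent,
      not_provable_neg_starSentence hb hf hg h⟩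
  refine ⟨fun h => ⟨starSentence_isTrue_of_oneConsistent hb hf hg h,
      not_provable_starSentence hb hf hg h⟩,
    starSentence_isTrue_of_not_consistent hf hg, fun h => provable_starInstance hb ?_, two,
    fun h => two h.twoConsistent⟩
  -- Either alternative makes `(***)` true, and its numerical instances are then true `Σ⁰₁`
  -- sentences, hence provable.
  exact h.elim (starSentence_isTrue_of_oneConsistent hb hf hg)
    (starSentence_isTrue_of_not_consistent hf hg)
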